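/- \textbf{Setting.} For $n\ge 1$ let $C_n\subseteq\mathbb{R}^2$ be the circle of radius $1/n$ centered at $(1/n,0)$, let $\mathbb{H}=\bigcup_{n\ge 1}C_n\subseteq\mathbb{R}^2$ be the Hawaiian Earring with base point $b_0=(0,0)$, and let $\ell_n:[0,1]\to C_n$, $\ell_n(t)=\left(\tfrac1n(1-\cos 2\pi t),\tfrac1n\sin 2\pi t\right)$. Let $P_n$ ($n\ge 1$) be copies of a pair of pants $D\setminus(D_1^\circ\cup D_2^\circ)$, where $D_1,D_2$ are disjoint closed disks in the interior of a closed disk $D\subseteq\mathbb{R}^2$; for definiteness, $D$ is the closed unit disk centered at the origin and $D_1,D_2$ are the closed disks of radius $1/4$ centered at $(0,1/2)$ and $(0,-1/2)$. Let $\alpha_n,\beta_n,\gamma_n:[0,1]\to P_n$ be the clockwise parametrizations, at constant speed and starting at the leftmost point, of $\partial D$, $\partial D_1$, $\partial D_2$, respectively. The \emph{Hawaiian Pants} $\mathbb{P}=\mathbb{H}\cup_f\coprod_{n\ge 1}P_n$ is the adjunction space (with the quotient topology) obtained from $\mathbb{H}$ by attaching all $P_n$ via the maps $f_n:\partial P_n\to\mathbb{H}$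 with $f_n\circ\alpha_n=\ell_n$, $f_n\circ\beta_n=\ell_{2n}$ and $f_n\circ\gamma_n=\ell_{2n+1}$. A continuous map $q:\widehat X\to X$ to a path-connected space $X$ is a \emph{generalized covering projection} if $\widehat X$ is nonempty, connected and locally path connected and if for every $\widehat x\in\widehat X$, every connected and locally path-connected space $Y$, every $y\in Y$, and every continuous map $f:(Y,y)\to(X,q(\widehat x))$ with $f_\#\pi_1(Y,y)\leqslant q_\#\pi_1(\widehat X,\widehat x)$, there is a unique continuous map $g:(Y,y)\to(\widehat X,\widehat x)$ with $q\circ g=f$. Let $\widetilde{\mathbb{P}}$ be the set of homotopy classes $[\alpha]$ (relative to endpoints) of paths $\alpha$ in $\mathbb{P}$ with $\alpha(0)=b_0$, with the topology generated by the sets $\langle\alpha,U\rangle=\{[\alpha\cdot\gamma]\mid \gamma \text{ a path in } U \text{ with } \gamma(0)=\alpha(1)\}$, where $U\subseteq\mathbb{P}$ is open and $\alpha(1)\in U$. Let $\widetilde b_0\in\widetilde{\mathbb{P}}$ be the class of the constant path at $b_0$ and let $p:\widetilde{\mathbb{P}}\to\mathbb{P}$, $p([\alpha])=\alpha(1)$,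 be the endpoint projection. \textbf{Theorem.} The map $p:\widetilde{\mathbb{P}}\to\mathbb{P}$ is a generalized covering projection (in particular, $\mathbb{P}$ is path connected), $\pi_1(\widetilde{\mathbb{P}},\widetilde b_0)=\{1\}$, and $\widetilde{\mathbb{P}}$ is simply connected. In particular, $\mathbb{P}$ admits a generalized covering projection whose domain is simply connected. -/

import Mathlib

universe w

namespace HawaiianPants

open scoped unitInterval

noncomputable section

/-! ## Generalized covering projections -/

/-- A map `q : E → X` into a path-connected space `X` is a generalized covering projection if `E`
is nonempty, connected and locally path connected and if, for every `e : E`, every connected and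
locally path-connected space `Y`, every `y : Y` and every map `f : (Y, y) → (X, q e)` with
`f_# π₁(Y, y) ≤ q_# π₁(E, e)`, there is a unique map `g : (Y, y) → (E, e)` with `q ∘ g = f`.
(`ConnectedSpace` includes nonemptiness; the spaces `Y` range over an arbitrary universe `w`.) -/
structure IsGeneralizedCoveringProjection {E X : Type*} [TopologicalSpace E] [TopologicalSpace X]
    (q : C(E, X)) : Prop where
  pathConnected_base : PathConnectedSpace X
  connected : ConnectedSpace E
  locPathConnected : LocallyPathConnectedSpace E
  existsUnique_lift : ∀ (e : E) (Y : Type w) [TopologicalSpace Y] [ConnectedSpace Y]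
    [LocallyPathConnectedSpace Y] (y : Y) (f : C(Y, X)) (hf : f y = q e),
    (FundamentalGroup.mapOfEq f hf).range ≤ (FundamentalGroup.map q e).range →
      ∃! g : C(Y, E), g y = e ∧ q.comp g = f

/-! ## The space of homotopy classes of based paths -/

/-- The set of all path-homotopy classes (rel endpoints) of paths in `X` starting at `x₀`. -/
structure PathClass (X : Type*) [TopologicalSpace X] (x₀ : X) where
  endpoint : X
  cls : Path.Homotopic.Quotient x₀ endpoint

namespace PathClass

variable {X : Type*} [TopologicalSpace X] {x₀ : X}

/-- The class `[α · γ]`, for `a = [α]` and a path `γ` starting at the endpoint of `α`. -/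
def append (a : PathClass X x₀) {x : X} (γ : Path a.endpoint x) : PathClass X x₀ :=
  ⟨x, a.cls.trans (Path.Homotopic.Quotient.mk γ)⟩

/-- The set `⟨α, U⟩` of all `[α · γ]` with `γ` a path in `U` starting at the endpoint of `α`. -/
def basicSet (a : PathClass X x₀) (U : Set X) : Set (PathClass X x₀) :=
  {b | ∃ (x : X) (γ : Path a.endpoint x), Set.range γ ⊆ U ∧ b = a.append γ}

/-- The topology generated by the sets `⟨α, U⟩` with `U` open and containing the endpoint of `α`. -/
instance : TopologicalSpace (PathClass X x₀) :=
  TopologicalSpace.generateFrom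
    {S | ∃ (a : PathClass X x₀) (U : Set X), IsOpen U ∧ a.endpoint ∈ U ∧ S = a.basicSet U}

variable (X x₀) in
/-- The class of the constant path at `x₀`. -/
def base : PathClass X x₀ := ⟨x₀, Path.Homotopic.Quotient.refl x₀⟩

theorem continuous_endpoint : Continuous (endpoint : PathClass X x₀ → X) := by
  refine continuous_def.2 fun U hU => ?_
  have key : endpoint ⁻¹' U = ⋃ a ∈ {a : PathClass X x₀ | a.endpoint ∈ U}, a.basicSet U := by
    ext b
    simp only [Set.mem_preimage, Set.mem_ofPred_eq, Set.mem_iUnion, exists_prop]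
    constructor
    · intro hb
      refine ⟨b, hb, b.endpoint, Path.refl _, ?_, ?_⟩
      · rintro _ ⟨t, rfl⟩
        simpa using hb
      · obtain ⟨x, c⟩ := b
        induction c using Path.Homotopic.Quotient.ind with
        | _ p =>
          simp only [append, PathClass.mk.injEq, heq_eq_eq, true_and]
          rw [← Path.Homotopic.Quotient.mk_trans]
          exact (Path.Homotopic.Quotient.eq.2 ⟨(Path.Homotopy.transRefl p).symm⟩)
    · rintro ⟨a, _, x, γ, hγ, rfl⟩
      exact hγ ⟨1, by simp [append]⟩
  rw [key]
  exact isOpen_biUnion fun a ha => TopologicalSpace.isOpen_generateFrom_of_mem ⟨a, U, hU, ha, rfl⟩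

variable (X x₀) in
/-- The endpoint projection `[α] ↦ α 1`. -/
def endpointProj : C(PathClass X x₀, X) := ⟨endpoint, continuous_endpoint⟩

end PathClass

/-! ## The Hawaiian Earring, the pair of pants and the Hawaiian Pants

The plane `ℝ²` is identified with `ℂ`. -/

/-- The clockwise parametrization of the circle with centre `c` and radius `r` that starts at the
leftmost point `c - r`. -/
def circleLoop (c : ℂ) (r : ℝ) (t : I) : ℂ :=
  c - r * Complex.exp (-(2 * Real.pi * (t : ℝ)) * Complex.I)

theorem circleLoop_re (c : ℂ) (r : ℝ) (t : I) :
    (circleLoop c r t).re = c.re - r * Real.cos (2 * Real.pi * t) := by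
  have h : (-(2 * Real.pi * (t : ℝ)) * Complex.I : ℂ)
      = ((-(2 * Real.pi * t) : ℝ) : ℂ) * Complex.I := by push_cast; ring
  rw [circleLoop, h, Complex.sub_re, Complex.re_ofReal_mul, Complex.exp_ofReal_mul_I_re,
    Real.cos_neg]

theorem circleLoop_im (c : ℂ) (r : ℝ) (t : I) :
    (circleLoop c r t).im = c.im + r * Real.sin (2 * Real.pi * t) := by
  have h : (-(2 * Real.pi * (t : ℝ)) * Complex.I : ℂ)
      = ((-(2 * Real.pi * t) : ℝ) : ℂ) * Complex.I := by push_cast; ring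
  rw [circleLoop, h, Complex.sub_im, Complex.im_ofReal_mul, Complex.exp_ofReal_mul_I_im,
    Real.sin_neg]
  ring

theorem dist_circleLoop (c : ℂ) {r : ℝ} (hr : 0 ≤ r) (t : I) : dist (circleLoop c r t) c = r := by
  have h : (-(2 * Real.pi * (t : ℝ)) * Complex.I : ℂ)
      = ((-(2 * Real.pi * t) : ℝ) : ℂ) * Complex.I := by push_cast; ring
  rw [circleLoop, h, dist_eq_norm, sub_sub_cancel_left, norm_neg, norm_mul,
    Complex.norm_exp_ofReal_mul_I, Complex.norm_real, Real.norm_of_nonneg hr, mul_one]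

/-- The Hawaiian Earring: the union of the circles `C_n`, `n ≥ 1`, of radius `1 / n` centred at
`(1 / n, 0)`, as a subset of the plane. -/
def earring : Set ℂ := ⋃ n : ℕ+, Metric.sphere (((1 / n : ℝ) : ℂ)) (1 / n)

/-- The loop `ℓ_n (t) = ((1 - cos 2πt) / n, (sin 2πt) / n)` in the Hawaiian Earring. -/
def ell (n : ℕ+) (t : I) : earring :=
  ⟨circleLoop ((1 / n : ℝ) : ℂ) (1 / n) t,
    Set.mem_iUnion.2 ⟨n, dist_circleLoop _ (by positivity) t⟩⟩

/-- A pair of pants: the closed unit disk with the interiors of the two disjoint closed disks of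
radius `1 / 4` centred at `(0, 1 / 2)` and `(0, -1 / 2)` removed. -/
def pants : Set ℂ :=
  Metric.closedBall 0 1 \
    (Metric.ball (Complex.I / 2) (1 / 4) ∪ Metric.ball (-(Complex.I / 2)) (1 / 4))

theorem mem_pants {z : ℂ} : z ∈ pants ↔
    dist z 0 ≤ 1 ∧ 1 / 4 ≤ dist z (Complex.I / 2) ∧ 1 / 4 ≤ dist z (-(Complex.I / 2)) := by
  simp [pants, not_or]

theorem dist_half_zero : dist (Complex.I / 2) 0 = 1 / 2 ∧ dist (-(Complex.I / 2)) 0 = 1 / 2 ∧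
    dist (Complex.I / 2) (-(Complex.I / 2)) = 1 := by
  refine ⟨by simp, by simp, ?_⟩
  rw [dist_eq_norm, sub_neg_eq_add, add_halves, Complex.norm_I]

/-- The clockwise parametrization of the outer boundary circle of the pair of pants. -/
def alpha (t : I) : pants :=
  ⟨circleLoop 0 1 t, by
    obtain ⟨h₁, h₂, -⟩ := dist_half_zero
    have h := dist_circleLoop 0 zero_le_one t
    refine mem_pants.2 ⟨h.le, ?_, ?_⟩
    · linarith [dist_triangle (circleLoop 0 1 t) (Complex.I / 2) 0]
    · linarith [dist_triangle (circleLoop 0 1 t) (-(Complex.I / 2)) 0]⟩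

/-- The clockwise parametrization of the first inner boundary circle of the pair of pants. -/
def beta (t : I) : pants :=
  ⟨circleLoop (Complex.I / 2) (1 / 4) t, by
    obtain ⟨h₁, h₂, h₃⟩ := dist_half_zero
    have h := dist_circleLoop (Complex.I / 2) (show (0 : ℝ) ≤ 1 / 4 by norm_num) t
    refine mem_pants.2 ⟨?_, h.ge, ?_⟩
    · linarith [dist_triangle (circleLoop (Complex.I / 2) (1 / 4) t) (Complex.I / 2) 0]
    · linarith [dist_triangle_left (Complex.I / 2) (-(Complex.I / 2))
        (circleLoop (Complex.I / 2) (1 / 4) t)]⟩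

/-- The clockwise parametrization of the second inner boundary circle of the pair of pants. -/
def gamma (t : I) : pants :=
  ⟨circleLoop (-(Complex.I / 2)) (1 / 4) t, by
    obtain ⟨h₁, h₂, h₃⟩ := dist_half_zero
    have h := dist_circleLoop (-(Complex.I / 2)) (show (0 : ℝ) ≤ 1 / 4 by norm_num) t
    refine mem_pants.2 ⟨?_, ?_, h.ge⟩
    · linarith [dist_triangle (circleLoop (-(Complex.I / 2)) (1 / 4) t) (-(Complex.I / 2)) 0]
    · linarith [dist_triangle_left (Complex.I / 2) (-(Complex.I / 2))
        (circleLoop (-(Complex.I / 2)) (1 / 4) t)]⟩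

/-- The identifications made when the `n`-th pair of pants `P_n` (`n ≥ 1`) is attached to the
Hawaiian Earring by the map `f_n : ∂P_n → ℍ` with `f_n ∘ α_n = ℓ_n`, `f_n ∘ β_n = ℓ_{2n}` and
`f_n ∘ γ_n = ℓ_{2n+1}`. -/
inductive Glue : earring ⊕ (Σ _ : ℕ+, pants) → earring ⊕ (Σ _ : ℕ+, pants) → Prop
  | outer (n : ℕ+) (t : I) : Glue (Sum.inr ⟨n, alpha t⟩) (Sum.inl (ell n t))
  | inner₁ (n : ℕ+) (t : I) : Glue (Sum.inr ⟨n, beta t⟩) (Sum.inl (ell (2 * n) t))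
  | inner₂ (n : ℕ+) (t : I) : Glue (Sum.inr ⟨n, gamma t⟩) (Sum.inl (ell (2 * n + 1) t))

/-- The Hawaiian Pants: the adjunction space obtained from the disjoint union of the Hawaiian
Earring and of countably many pairs of pants by these identifications, with the quotient topology
(`Quot` takes the quotient by the equivalence relation generated by `Glue`). -/
abbrev Space : Type := Quot Glue

/-- The base point `b₀`: the image in the Hawaiian Pants of the origin of the plane. -/
def b₀ : Space :=
  Quot.mk Glue (Sum.inl ⟨0, Set.mem_iUnion.2 ⟨1, by simp⟩⟩)

/-- The space `ℙ̃` of homotopy classes of paths in the Hawaiian Pants starting at `b₀`. -/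
abbrev UnivCover : Type := PathClass Space b₀

/-- The endpoint projection `p : ℙ̃ → ℙ`. -/
abbrev proj : C(UnivCover, Space) := PathClass.endpointProj Space b₀

/-- The base point of `ℙ̃`: the class of the constant path at `b₀`. -/
abbrev univBase : UnivCover := PathClass.base Space b₀

end

end HawaiianPants

open scoped unitInterval Topology

namespace HawaiianPants

/-! Everything follows from one property of `Space`, `HasUniquePathLifting`: a path in ℙ̃ is always
the standard lift t ↦ [α · γ|[0,t]] of its projection γ. Lifts through p are then unique. A loop in
ℙ̃ projects to a null-homotopic loop, and the null-homotopy lifts back, so ℙ̃ is simply connected.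
Hence p_# has trivial image, the lifting criterion concerns maps that kill all loops, and such maps
lift by sending a point to the class of the image of any path leading to it.

The property is local in the base (`HasUniquePathLifting.of_local`). Over an open set that deforms
inside ℙ to a space Z, it is inherited from Z as soon as Z → ℙ is injective on path classes
(`PathClass.joins_of_deformation`). ℙ is covered by small discs inside the pairs of pants and by a
collar that is pushed radially into ℍ. Two facts about ℍ remain.

Unique path lifting for ℍ. Every point has small neighbourhoods that are fixed pointwise by a
self-map of ℍ with small image (`IsLocallyRetractable`), so homotopies between small paths can be
made small. A path of path classes is approximated by finer and finer concatenations of short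
realizing paths; consecutive approximations are joined by small homotopies, and these converge to a
homotopy from the first approximation to the projected path.

Injectivity of ℍ → ℙ on path classes (`homotopic_of_map_mkE`). No retraction ℙ → ℍ exists, since ℓ_n
becomes homologous to ℓ_{2n} + ℓ_{2n+1} in ℙ. Instead there is an infinite-sheeted covering of ℙ
with a map to ℍ that is the identity on one lift of ℍ; lifting a homotopy to the covering and
applying that map gives the claim. On every other lift of ℍ, finitely many circles go to one common
circle C_x and all others collapse. A lifted pair of pants either maps to a point, or maps to some
C_x with winding number one on the outer and one inner boundary circle, the other inner circle
collapsing. The lifts are matched along boundary circles by permutations of the sheets respecting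
these labels, which exist because each label occurs on infinitely many sheets. -/

theorem path_refl_cast {X : Type*} [TopologicalSpace X] {x y : X} (h : y = x) :
    (Path.refl x).cast h h = Path.refl y := by
  subst h
  rfl

instance : ContractibleSpace I :=
  (convex_Icc (0 : ℝ) 1).contractibleSpace ⟨0, by simp⟩

instance : LocallyPathConnectedSpace I :=
  (convex_Icc (0 : ℝ) 1).locallyPathConnectedSpace

/-! ### Path classes, their topology and standard lifts -/

namespace PathClass

variable {X : Type*} [TopologicalSpace X] {x₀ : X}

/-- `Joins a b γ` says that `b = [α · γ]` where `a = [α]`. -/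
def Joins (a b : PathClass X x₀) (γ : Path a.endpoint b.endpoint) : Prop :=
  a.cls.trans (Path.Homotopic.Quotient.mk γ) = b.cls

theorem Joins.refl (a : PathClass X x₀) : Joins a a (Path.refl _) := by
  simp [Joins]

theorem Joins.trans {a b c : PathClass X x₀} {γ : Path a.endpoint b.endpoint}
    {δ : Path b.endpoint c.endpoint} (h : Joins a b γ) (h' : Joins b c δ) :
    Joins a c (γ.trans δ) := by
  unfold Joins at *
  rw [Path.Homotopic.Quotient.mk_trans, ← Path.Homotopic.Quotient.trans_assoc, h, h']

theorem Joins.symm {a b : PathClass X x₀} {γ : Path a.endpoint b.endpoint} (h : Joins a b γ) :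
    Joins b a γ.symm := by
  unfold Joins at *
  rw [← h, Path.Homotopic.Quotient.mk_symm]
  simp

theorem Joins.of_homotopic {a b : PathClass X x₀} {γ δ : Path a.endpoint b.endpoint}
    (h : Joins a b γ) (hγ : γ.Homotopic δ) : Joins a b δ := by
  unfold Joins at *
  rwa [← Path.Homotopic.Quotient.eq.2 hγ]

theorem Joins.homotopic {a b : PathClass X x₀} {γ δ : Path a.endpoint b.endpoint}
    (h : Joins a b γ) (h' : Joins a b δ) : γ.Homotopic δ := by
  unfold Joins at *
  have h₁ : (a.cls.symm).trans (a.cls.trans (Path.Homotopic.Quotient.mk γ)) =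
      (a.cls.symm).trans (a.cls.trans (Path.Homotopic.Quotient.mk δ)) := by rw [h, h']
  rw [← Path.Homotopic.Quotient.trans_assoc, ← Path.Homotopic.Quotient.trans_assoc] at h₁
  simpa [Path.Homotopic.Quotient.eq] using h₁

theorem joins_append (a : PathClass X x₀) {x : X} (γ : Path a.endpoint x) :
    Joins a (a.append γ) γ := rfl

theorem joins_append_append (a : PathClass X x₀) {x y : X} {γ : Path a.endpoint x}
    {γ' : Path a.endpoint y} {δ : Path x y} (h : (γ.trans δ).Homotopic γ') :
    Joins (a.append γ) (a.append γ') δ := by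
  change (a.cls.trans (Path.Homotopic.Quotient.mk γ)).trans (Path.Homotopic.Quotient.mk δ) =
    a.cls.trans (Path.Homotopic.Quotient.mk γ')
  rw [Path.Homotopic.Quotient.trans_assoc, ← Path.Homotopic.Quotient.mk_trans,
    Path.Homotopic.Quotient.eq.2 h]

theorem Joins.eq_append {a b : PathClass X x₀} {γ : Path a.endpoint b.endpoint}
    (h : Joins a b γ) : b = a.append γ := by
  obtain ⟨x, c⟩ := b
  unfold Joins at h
  simp only [append, h]

theorem Joins.eq_of_forall {a b c : PathClass X x₀} {γ : Path a.endpoint b.endpoint}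
    {δ : Path a.endpoint c.endpoint} (h : Joins a b γ) (h' : Joins a c δ)
    (hγ : ∀ t, γ t = δ t) : b = c := by
  rw [h.eq_append, h'.eq_append]
  have e : b.endpoint = c.endpoint := by simpa using hγ 1
  clear h h'
  obtain ⟨x, d⟩ := b
  obtain ⟨y, d'⟩ := c
  dsimp only at e γ δ
  subst e
  have : γ = δ := Path.ext (funext hγ)
  rw [this]

theorem mem_basicSet_iff {a b : PathClass X x₀} {U : Set X} :
    b ∈ a.basicSet U ↔ ∃ γ : Path a.endpoint b.endpoint, Set.range γ ⊆ U ∧ Joins a b γ := by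
  constructor
  · rintro ⟨x, γ, hγ, rfl⟩
    exact ⟨γ, hγ, rfl⟩
  · rintro ⟨γ, hγ, h⟩
    exact ⟨_, γ, hγ, h.eq_append⟩

theorem mem_basicSet_self {a : PathClass X x₀} {U : Set X} (ha : a.endpoint ∈ U) :
    a ∈ a.basicSet U := by
  refine mem_basicSet_iff.2 ⟨Path.refl _, ?_, Joins.refl a⟩
  rintro _ ⟨t, rfl⟩
  exact ha

theorem mem_basicSet_symm {a b : PathClass X x₀} {U : Set X} (h : b ∈ a.basicSet U) :
    a ∈ b.basicSet U := by
  obtain ⟨γ, hγ, h⟩ := mem_basicSet_iff.1 h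
  exact mem_basicSet_iff.2 ⟨γ.symm, by rwa [Path.symm_range], h.symm⟩

theorem mem_basicSet_trans {a b c : PathClass X x₀} {U : Set X} (h : b ∈ a.basicSet U)
    (h' : c ∈ b.basicSet U) : c ∈ a.basicSet U := by
  obtain ⟨γ, hγ, h⟩ := mem_basicSet_iff.1 h
  obtain ⟨δ, hδ, h'⟩ := mem_basicSet_iff.1 h'
  refine mem_basicSet_iff.2 ⟨γ.trans δ, ?_, h.trans h'⟩
  rw [Path.trans_range]
  exact Set.union_subset hγ hδ

theorem endpoint_mem_of_mem_basicSet {a b : PathClass X x₀} {U : Set X} (h : b ∈ a.basicSet U) :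
    b.endpoint ∈ U := by
  obtain ⟨γ, hγ, -⟩ := mem_basicSet_iff.1 h
  exact hγ ⟨1, γ.target⟩

theorem basicSet_mono {a : PathClass X x₀} {U V : Set X} (h : U ⊆ V) :
    a.basicSet U ⊆ a.basicSet V := by
  rintro _ ⟨x, γ, hγ, rfl⟩
  exact ⟨x, γ, hγ.trans h, rfl⟩

theorem isOpen_basicSet {a : PathClass X x₀} {U : Set X} (hU : IsOpen U) (ha : a.endpoint ∈ U) :
    IsOpen (a.basicSet U) :=
  TopologicalSpace.isOpen_generateFrom_of_mem ⟨a, U, hU, ha, rfl⟩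

/-- A generating set ⟨α, U⟩ can be recentred at any of its elements, so the generating sets
containing b may be replaced by sets ⟨b, U⟩, which are closed under finite intersection up to
shrinking U. -/
theorem hasBasis_nhds (b : PathClass X x₀) :
    (𝓝 b).HasBasis (fun U : Set X => IsOpen U ∧ b.endpoint ∈ U) b.basicSet := by
  have key : ∀ S : Set (PathClass X x₀), IsOpen S → ∀ b ∈ S,
      ∃ U : Set X, (IsOpen U ∧ b.endpoint ∈ U) ∧ b.basicSet U ⊆ S := by
    intro S hS
    induction hS with
    | basic S hS =>
      obtain ⟨a, U, hU, ha, rfl⟩ := hS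
      exact fun b hb => ⟨U, ⟨hU, endpoint_mem_of_mem_basicSet hb⟩,
        fun c hc => mem_basicSet_trans hb hc⟩
    | univ => exact fun b _ => ⟨Set.univ, ⟨isOpen_univ, trivial⟩, Set.subset_univ _⟩
    | inter S T _ _ hS hT =>
      intro b hb
      obtain ⟨U, ⟨hU, hbU⟩, h⟩ := hS b hb.1
      obtain ⟨V, ⟨hV, hbV⟩, h'⟩ := hT b hb.2
      exact ⟨U ∩ V, ⟨hU.inter hV, hbU, hbV⟩, Set.subset_inter
        ((basicSet_mono Set.inter_subset_left).trans h)
        ((basicSet_mono Set.inter_subset_right).trans h')⟩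
    | sUnion 𝒮 _ h =>
      rintro b ⟨S, hS, hb⟩
      obtain ⟨U, hU, h'⟩ := h S hS b hb
      exact ⟨U, hU, h'.trans (Set.subset_sUnion_of_mem hS)⟩
  refine ⟨fun S => ?_⟩
  rw [mem_nhds_iff]
  constructor
  · rintro ⟨T, hTS, hT, hb⟩
    obtain ⟨U, hU, h⟩ := key T hT b hb
    exact ⟨U, hU, h.trans hTS⟩
  · rintro ⟨U, hU, h⟩
    exact ⟨_, h, isOpen_basicSet hU.1 hU.2, mem_basicSet_self hU.2⟩

/-- The class of `γ` restricted to `[0, t]`, appended to `a`. -/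
noncomputable def appendUpTo (a : PathClass X x₀) {x : X} (γ : Path a.endpoint x) (t : I) :
    PathClass X x₀ :=
  a.append ((γ.subpath 0 t).cast γ.source.symm rfl)

theorem joins_appendUpTo (a : PathClass X x₀) {x : X} (γ : Path a.endpoint x) (s t : I) :
    Joins (a.appendUpTo γ s) (a.appendUpTo γ t) (γ.subpath s t) := by
  refine joins_append_append a ?_
  have h : ((γ.subpath 0 s).trans (γ.subpath s t)).Homotopic (γ.subpath 0 t) :=
    ⟨Path.Homotopy.subpathTransSubpath γ 0 s t⟩
  exact h.pathCast γ.source.symm rfl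

theorem appendUpTo_zero (a : PathClass X x₀) {x : X} (γ : Path a.endpoint x) :
    a.appendUpTo γ 0 = a := by
  refine (joins_append a _).eq_of_forall (Joins.refl a) fun t => ?_
  rw [Path.subpath_self]
  exact γ.source

theorem appendUpTo_one (a : PathClass X x₀) {x : X} (γ : Path a.endpoint x) :
    a.appendUpTo γ 1 = a.append γ := by
  refine (joins_append a _).eq_of_forall (joins_append a γ) fun t => ?_
  rw [Path.subpath_zero_one]
  rfl

theorem continuous_appendUpTo (a : PathClass X x₀) {x : X} (γ : Path a.endpoint x) :
    Continuous (a.appendUpTo γ) := by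
  rw [continuous_iff_continuousAt]
  intro t
  refine ((hasBasis_nhds _).tendsto_right_iff).2 ?_
  rintro U ⟨hU, htU⟩
  have hU' : γ ⁻¹' U ∈ 𝓝 t := (hU.preimage γ.continuous).mem_nhds htU
  obtain ⟨ε, hε, hεU⟩ := Metric.mem_nhds_iff.1 hU'
  filter_upwards [Metric.ball_mem_nhds t hε] with s hs
  refine mem_basicSet_iff.2 ⟨γ.subpath t s, (Path.range_subpath γ t s).trans_subset ?_,
    joins_appendUpTo a γ t s⟩
  rintro _ ⟨r, hr, rfl⟩
  refine hεU (Metric.mem_ball.2 (lt_of_le_of_lt ?_ (Metric.mem_ball.1 hs)))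
  rw [Subtype.dist_eq, Subtype.dist_eq, Real.dist_eq, Real.dist_eq]
  refine Set.abs_sub_left_of_mem_uIcc (a := (t : ℝ)) ?_
  rcases Set.mem_uIcc.1 hr with h | h
  · exact Set.mem_uIcc.2 (Or.inl h)
  · exact Set.mem_uIcc.2 (Or.inr h)

/-- The path `t ↦ [α · γ|[0,t]]` from `a = [α]` to `[α · γ]`. -/
noncomputable def appendPath (a : PathClass X x₀) {x : X} (γ : Path a.endpoint x) :
    Path a (a.append γ) where
  toFun := a.appendUpTo γ
  continuous_toFun := continuous_appendUpTo a γ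
  source' := appendUpTo_zero a γ
  target' := appendUpTo_one a γ

@[simp] theorem endpoint_appendPath (a : PathClass X x₀) {x : X} (γ : Path a.endpoint x) (t : I) :
    (a.appendPath γ t).endpoint = γ t := by
  rfl

theorem appendPath_mem_basicSet (a : PathClass X x₀) {x : X} (γ : Path a.endpoint x) {U : Set X}
    (hγ : Set.range γ ⊆ U) (t : I) : a.appendPath γ t ∈ a.basicSet U := by
  refine ⟨_, (γ.subpath 0 t).cast γ.source.symm rfl, ?_, rfl⟩
  rintro _ ⟨s, rfl⟩
  exact hγ ⟨_, rfl⟩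

theorem Joins.exists_path {a b : PathClass X x₀} {γ : Path a.endpoint b.endpoint}
    (h : Joins a b γ) : ∃ Γ : Path a b, ∀ t, (Γ t).endpoint = γ t :=
  ⟨(a.appendPath γ).cast rfl h.eq_append, fun t => endpoint_appendPath a γ t⟩

theorem isPathConnected_basicSet {a : PathClass X x₀} {U : Set X} (ha : a.endpoint ∈ U) :
    IsPathConnected (a.basicSet U) := by
  refine ⟨a, mem_basicSet_self ha, ?_⟩
  rintro _ ⟨x, γ, hγ, rfl⟩
  exact ⟨a.appendPath γ, appendPath_mem_basicSet a γ hγ⟩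

instance : LocallyPathConnectedSpace (PathClass X x₀) :=
  .of_bases hasBasis_nhds fun _ _ h => isPathConnected_basicSet h.2

instance : PathConnectedSpace (PathClass X x₀) where
  nonempty := ⟨base X x₀⟩
  joined := by
    have h : ∀ a : PathClass X x₀, Joined (base X x₀) a := by
      rintro ⟨x, c⟩
      induction c using Path.Homotopic.Quotient.ind with
      | _ γ =>
        have : Joins (base X x₀) ⟨x, Path.Homotopic.Quotient.mk γ⟩ γ := by
          unfold Joins
          exact Path.Homotopic.Quotient.refl_trans _
        exact ⟨this.exists_path.choose⟩
    exact fun a b => (h a).symm.trans (h b)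

/-! ### Unique path lifting and its consequences -/

/-- The path lifting property: every path `Γ` in the space of path classes is the standard lift of
its image under the endpoint projection. -/
def HasUniquePathLifting (X : Type*) [TopologicalSpace X] (x₀ : X) : Prop :=
  ∀ (a b : PathClass X x₀) (Γ : Path a b), Joins a b (Γ.map continuous_endpoint)

/-- Along a path from y to z, both maps give the standard lift of the same path from the same
starting class. -/
theorem HasUniquePathLifting.eq_of_lifts (hX : HasUniquePathLifting X x₀) {Y : Type*}
    [TopologicalSpace Y] [PathConnectedSpace Y]
    {g g' : C(Y, PathClass X x₀)} {y : Y} (hy : g y = g' y)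
    (h : ∀ z, (g z).endpoint = (g' z).endpoint) : g = g' := by
  ext1 z
  let τ : Path y z := PathConnectedSpace.somePath y z
  have h₁ := hX _ _ (τ.map g.continuous)
  have h₂ := hX _ _ ((τ.map g'.continuous).cast hy rfl)
  exact h₁.eq_of_forall h₂ fun t => h _

theorem HasUniquePathLifting.homotopic_refl (hX : HasUniquePathLifting X x₀) {a : PathClass X x₀} (Γ : Path a a) :
    (Γ.map continuous_endpoint).Homotopic (Path.refl _) :=
  (hX a a Γ).homotopic (Joins.refl a)

/-- The value at z is `e` followed by the image of a chosen path from y to z. By `hloop` the choice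
does not matter, and short paths in Y, available by local path connectedness, give continuity. -/
theorem exists_lift {Y : Type*} [TopologicalSpace Y]
    [PathConnectedSpace Y] [LocallyPathConnectedSpace Y] (e : PathClass X x₀) (y : Y) (f : C(Y, X))
    (hf : f y = e.endpoint)
    (hloop : ∀ κ : Path y y, (κ.map f.continuous).Homotopic (Path.refl _)) :
    ∃ g : C(Y, PathClass X x₀), g y = e ∧ ∀ z, (g z).endpoint = f z := by
  classical
  let τ : ∀ z : Y, Path y z := fun z => PathConnectedSpace.somePath y z
  let g : Y → PathClass X x₀ := fun z => e.append (((τ z).map f.continuous).cast hf.symm rfl)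
  have key : ∀ z z' (κ : Path z z'), Joins (g z) (g z') (κ.map f.continuous) := by
    intro z z' κ
    refine joins_append_append e ?_
    have h := hloop (((τ z).trans κ).trans (τ z').symm)
    rw [← Path.Homotopic.Quotient.eq, Path.map_trans, Path.map_trans, Path.Homotopic.Quotient.mk_trans, ← Path.map_symm,
      Path.Homotopic.Quotient.mk_symm] at h
    have h' := congrArg (fun c => c.trans (Path.Homotopic.Quotient.mk ((τ z').map f.continuous))) h
    simp only [Path.Homotopic.Quotient.trans_assoc, Path.Homotopic.Quotient.symm_trans, Path.Homotopic.Quotient.trans_refl, Path.Homotopic.Quotient.mk_refl,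
      Path.Homotopic.Quotient.refl_trans] at h'
    exact (Path.Homotopic.Quotient.eq.1 h').pathCast hf.symm rfl
  have hg : Continuous g := by
    rw [continuous_iff_continuousAt]
    intro z
    refine ((hasBasis_nhds _).tendsto_right_iff).2 ?_
    rintro U ⟨hU, hzU⟩
    have hU' : f ⁻¹' U ∈ 𝓝 z := (hU.preimage f.continuous).mem_nhds hzU
    obtain ⟨C, ⟨hC, hpc⟩, hCU⟩ := (path_connected_basis z).mem_iff.1 hU'
    filter_upwards [hC] with z' hz'
    have hj := hpc.joinedIn z (mem_of_mem_nhds hC) z' hz'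
    refine mem_basicSet_iff.2 ⟨hj.somePath.map f.continuous, ?_, key z z' _⟩
    rintro _ ⟨t, rfl⟩
    exact hCU (hj.somePath_mem t)
  refine ⟨⟨g, hg⟩, ?_, fun z => rfl⟩
  have h := key y y (Path.refl y)
  refine (joins_append e _).eq_of_forall (c := e)
    (δ := ((τ y).map f.continuous).cast hf.symm hf.symm) ?_ fun t => rfl
  have := (hloop (τ y)).pathCast hf.symm hf.symm
  rw [path_refl_cast] at this
  exact (Joins.refl e).of_homotopic this.symm

/-- The projected loop is null-homotopic; the null-homotopy, defined on the simply connected square,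
lifts, and uniqueness of lifts determines the lift on all four sides. -/
theorem HasUniquePathLifting.homotopic_refl_of_loop (hX : HasUniquePathLifting X x₀) {a : PathClass X x₀} (Γ : Path a a) :
    Γ.Homotopic (Path.refl a) := by
  obtain ⟨H⟩ := hX.homotopic_refl Γ
  obtain ⟨G, hG₀, hG⟩ := exists_lift (Y := I × I) a (0, 0) ⟨H, H.continuous⟩ (by simp) (by
    intro κ
    have : κ.Homotopic (Path.refl _) := SimplyConnectedSpace.paths_homotopic _ _
    exact this.map ⟨H, H.continuous⟩)
  have hbot : ∀ t, G (0, t) = Γ t := by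
    have := hX.eq_of_lifts (Y := I) (g := G.comp ⟨fun t => (0, t), by fun_prop⟩)
      (g' := ⟨Γ, Γ.continuous⟩) (y := 0) (by simpa using hG₀) (fun t => by
        have := hG (0, t)
        simpa using this)
    exact fun t => DFunLike.congr_fun this t
  have hleft : ∀ s, G (s, 0) = a := by
    have := hX.eq_of_lifts (Y := I) (g := G.comp ⟨fun s => (s, 0), by fun_prop⟩)
      (g' := .const _ a) (y := 0) (by simpa using hG₀) (fun t => by
        have := hG (t, 0)
        simpa using this)
    exact fun t => DFunLike.congr_fun this t
  have hright : ∀ s, G (s, 1) = a := by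
    have := hX.eq_of_lifts (Y := I) (g := G.comp ⟨fun s => (s, 1), by fun_prop⟩)
      (g' := .const _ a) (y := 0) (by simpa using hbot 1) (fun t => by
        have := hG (t, 1)
        simpa using this)
    exact fun t => DFunLike.congr_fun this t
  have htop : ∀ t, G (1, t) = a := by
    have := hX.eq_of_lifts (Y := I) (g := G.comp ⟨fun t => (1, t), by fun_prop⟩)
      (g' := .const _ a) (y := 0) (by simpa using hleft 1) (fun t => by
        have := hG (1, t)
        simpa using this)
    exact fun t => DFunLike.congr_fun this t
  exact ⟨{ toFun := G
           continuous_toFun := G.continuous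
           map_zero_left := hbot
           map_one_left := htop
           prop' := by
             rintro s t (rfl | rfl)
             · simpa using hleft s
             · simpa using hright s }⟩

theorem HasUniquePathLifting.simplyConnectedSpace (hX : HasUniquePathLifting X x₀) : SimplyConnectedSpace (PathClass X x₀) :=
  simply_connected_iff_loops_nullhomotopic.2
    ⟨inferInstance, fun _ Γ => hX.homotopic_refl_of_loop Γ⟩

theorem HasUniquePathLifting.isGeneralizedCoveringProjection (hX : HasUniquePathLifting X x₀) [PathConnectedSpace X] :
    IsGeneralizedCoveringProjection.{w} (endpointProj X x₀) where
  pathConnected_base := inferInstance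
  connected := inferInstance
  locPathConnected := inferInstance
  existsUnique_lift := by
    intro e Y _ _ _ y f hf hle
    have : PathConnectedSpace Y := pathConnectedSpace_iff_connectedSpace.2 inferInstance
    have hloop : ∀ κ : Path y y, (κ.map f.continuous).Homotopic (Path.refl _) := by
      intro κ
      obtain ⟨c, hc⟩ := hle ⟨FundamentalGroup.fromPath (Path.Homotopic.Quotient.mk κ), rfl⟩
      -- As the total space is simply connected, p_# has trivial image, so the hypothesis on f says
      -- that f kills every loop.
      have hc₁ : c = 1 := by
        have := hX.simplyConnectedSpace
        exact Subsingleton.elim _ _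
      rw [hc₁, map_one, FundamentalGroup.mapOfEq_apply] at hc
      have hc' : (κ.map f.continuous).cast hf.symm hf.symm |>.Homotopic (Path.refl e.endpoint) :=
        (Path.Homotopic.Quotient.exact hc).symm
      have h₁ := hc'.pathCast hf hf
      have h₂ : (Path.refl e.endpoint).cast hf hf = Path.refl (f y) := path_refl_cast hf
      exact h₁.trans (h₂ ▸ Path.Homotopic.refl _)
    obtain ⟨g, hg, hgf⟩ := exists_lift e y f hf hloop
    refine ⟨g, ⟨hg, ContinuousMap.ext hgf⟩, ?_⟩
    rintro g' ⟨hg', hgf'⟩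
    refine hX.eq_of_lifts (hg'.trans hg.symm) fun z => ?_
    rw [hgf z]
    exact DFunLike.congr_fun hgf' z

end PathClass

/-! ### Localization and transfer of unique path lifting -/

namespace PathClass

variable {X : Type*} [TopologicalSpace X] {x₀ : X}

theorem Joins.congr {a b a' b' : PathClass X x₀} {γ : Path a.endpoint b.endpoint}
    {δ : Path a'.endpoint b'.endpoint} (h : Joins a b γ) (ha : a = a') (hb : b = b')
    (hγ : ∀ t, γ t = δ t) : Joins a' b' δ := by
  subst ha hb
  have : γ = δ := Path.ext (funext hγ)
  rwa [← this]

theorem Joins.of_trans {a b c : PathClass X x₀} {γ : Path a.endpoint b.endpoint}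
    {δ : Path b.endpoint c.endpoint} (h : Joins a b γ) (h' : Joins a c (γ.trans δ)) :
    Joins b c δ := by
  unfold Joins at *
  rw [← h, ← h', Path.Homotopic.Quotient.mk_trans, Path.Homotopic.Quotient.trans_assoc]

theorem HasUniquePathLifting.of_simplyConnected [SimplyConnectedSpace X] :
    HasUniquePathLifting X x₀ :=
  fun _ _ _ => Subsingleton.elim _ _

/-- Unique path lifting is a local property. -/
theorem HasUniquePathLifting.of_local
    (h : ∀ x : X, ∃ U : Set X, IsOpen U ∧ x ∈ U ∧ ∀ (a b : PathClass X x₀) (Γ : Path a b),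
      (∀ t, (Γ t).endpoint ∈ U) → Joins a b (Γ.map continuous_endpoint)) :
    HasUniquePathLifting X x₀ := by
  intro a b Γ
  choose U hU hxU hjoin using h
  -- A Lebesgue subdivision cuts Γ into pieces lying over single sets `U x`; the pieces are standard
  -- lifts, and standard lifts concatenate.
  obtain ⟨t, ht₀, hmono, ⟨N, hN⟩, htU⟩ := exists_monotone_Icc_subset_open_cover_unitInterval
    (c := fun x => (fun t => (Γ t).endpoint) ⁻¹' U x)
    (fun x => (hU x).preimage (continuous_endpoint.comp Γ.continuous))
    (fun t _ => Set.mem_iUnion.2 ⟨(Γ t).endpoint, hxU _⟩)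
  have key : ∀ n, Joins (Γ 0) (Γ (t n)) ((Γ.map continuous_endpoint).subpath 0 (t n)) := by
    intro n
    induction n with
    | zero =>
      refine (Joins.refl (Γ 0)).congr rfl (by rw [ht₀]) fun s => ?_
      rw [ht₀, Path.subpath_self]
      rfl
    | succ n ih =>
      obtain ⟨x, hx⟩ := htU n
      have hle : ∀ s, (Γ.subpath (t n) (t (n + 1)) s).endpoint ∈ U x := by
        intro s
        refine hx ?_
        have hle : t n ≤ t (n + 1) := hmono n.le_succ
        exact ⟨Set.Icc.le_convexComb hle s, Set.Icc.convexComb_le hle s⟩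
      have := hjoin x _ _ (Γ.subpath (t n) (t (n + 1))) hle
      exact (ih.trans this).of_homotopic ⟨Path.Homotopy.subpathTransSubpath _ 0 (t n) (t (n + 1))⟩
  have h₁ := key N
  refine h₁.congr Γ.source (by rw [hN N le_rfl, Γ.target]) fun s => ?_
  have hs : ∀ r : I, r = 1 → (Γ.map continuous_endpoint).subpath 0 r s =
      (Γ.map continuous_endpoint) s := by
    rintro _ rfl
    simp
  exact hs _ (hN N le_rfl)

/-- A homotopy between two maps conjugates the images of a path by its tracks. -/
theorem homotopic_trans_evalAt {Y : Type*} [TopologicalSpace Y] {f g : C(Y, X)}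
    (K : f.Homotopy g) {u v : Y} (γ : Path u v) :
    ((γ.map f.continuous).trans (K.evalAt v)).Homotopic
      ((K.evalAt u).trans (γ.map g.continuous)) := by
  let F : C(I × I, X) := ⟨fun p => K (p.1, γ p.2), by fun_prop⟩
  let P₀ : Path ((0, 0) : I × I) (0, 1) := ⟨⟨fun t => (0, t), by fun_prop⟩, rfl, rfl⟩
  let P₁ : Path ((0, 1) : I × I) (1, 1) := ⟨⟨fun t => (t, 1), by fun_prop⟩, rfl, rfl⟩
  let Q₀ : Path ((0, 0) : I × I) (1, 0) := ⟨⟨fun t => (t, 0), by fun_prop⟩, rfl, rfl⟩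
  let Q₁ : Path ((1, 0) : I × I) (1, 1) := ⟨⟨fun t => (1, t), by fun_prop⟩, rfl, rfl⟩
  have h : (P₀.trans P₁).Homotopic (Q₀.trans Q₁) := SimplyConnectedSpace.paths_homotopic _ _
  have h' := (h.map F).pathCast (x₂ := f u) (x₃ := g v) (by simp [F]) (by simp [F])
  convert h' using 1
  · ext t
    simp only [Path.trans_apply, Path.cast_coe, Path.map_coe, Function.comp_apply]
    split_ifs <;> simp [F, P₀, P₁, ContinuousMap.Homotopy.evalAt]
  · ext t
    simp only [Path.trans_apply, Path.cast_coe, Path.map_coe, Function.comp_apply]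
    split_ifs <;> simp [F, Q₀, Q₁, ContinuousMap.Homotopy.evalAt]

/-- The images under f and g differ by conjugation with the tracks of the endpoints, which are the
same for γ and δ. -/
theorem homotopic_map_iff_of_homotopy {Y : Type*} [TopologicalSpace Y] {f g : C(Y, X)}
    (K : f.Homotopy g) {u v : Y} (γ δ : Path u v) :
    (γ.map f.continuous).Homotopic (δ.map f.continuous) ↔
      (γ.map g.continuous).Homotopic (δ.map g.continuous) := by
  have h₁ := Path.Homotopic.Quotient.eq.2 (homotopic_trans_evalAt K γ)
  have h₂ := Path.Homotopic.Quotient.eq.2 (homotopic_trans_evalAt K δ)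
  simp only [Path.Homotopic.Quotient.mk_trans] at h₁ h₂
  rw [← Path.Homotopic.Quotient.eq, ← Path.Homotopic.Quotient.eq]
  constructor
  · intro h
    rw [h, h₂] at h₁
    have := congrArg (fun c => (Path.Homotopic.Quotient.mk (K.evalAt u)).symm.trans c) h₁
    simpa [← Path.Homotopic.Quotient.trans_assoc] using this.symm
  · intro h
    rw [h, ← h₂] at h₁
    have := congrArg (fun c => c.trans (Path.Homotopic.Quotient.mk (K.evalAt v)).symm) h₁
    simpa using this

/-- The sets ⟨c, U⟩ are open and any two are equal or disjoint, so each is relatively clopen over U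
and a connected path stays in one of them. -/
theorem mem_basicSet_of_path {a b : PathClass X x₀} {U : Set X} (hU : IsOpen U) (Γ : Path a b)
    (hΓ : ∀ t, (Γ t).endpoint ∈ U) (t : I) : Γ t ∈ a.basicSet U := by
  have hopen : ∀ c : PathClass X x₀, c.endpoint ∈ U → IsOpen {s | Γ s ∈ c.basicSet U} :=
    fun c hc => (isOpen_basicSet hU hc).preimage Γ.continuous
  have ha : a.endpoint ∈ U := by simpa using hΓ 0
  have hclopen : IsClopen {s | Γ s ∈ a.basicSet U} := by
    refine ⟨?_, hopen a ha⟩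
    rw [← isOpen_compl_iff, isOpen_iff_mem_nhds]
    intro s hs
    filter_upwards [(hopen _ (hΓ s)).mem_nhds (mem_basicSet_self (hΓ s))] with r hr hr'
    exact hs (mem_basicSet_trans hr' (mem_basicSet_symm hr))
  have := hclopen.eq_univ ⟨0, by simpa using mem_basicSet_self ha⟩
  exact this.ge (Set.mem_univ t)

/-- Paths of path classes lying over an open set `U` that is deformed, within `X`, to a space `Z`
with unique path lifting whose fundamental groupoid embeds into that of `X`, are standard lifts. -/
theorem joins_of_deformation {Z : Type*} [TopologicalSpace Z] {U : Set X} (hU : IsOpen U)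
    (r : C(U, Z)) (i : C(Z, X))
    (K : (i.comp r).Homotopy (⟨Subtype.val, continuous_subtype_val⟩ : C(U, X)))
    (hZ : ∀ z, HasUniquePathLifting Z z)
    (hi : ∀ {z z' : Z} (γ δ : Path z z'),
      (γ.map i.continuous).Homotopic (δ.map i.continuous) → γ.Homotopic δ)
    {a b : PathClass X x₀} (Γ : Path a b) (hΓ : ∀ t, (Γ t).endpoint ∈ U) :
    Joins a b (Γ.map continuous_endpoint) := by
  have hval : Continuous (Subtype.val : U → X) := continuous_subtype_val
  let u : I → U := fun t => ⟨(Γ t).endpoint, hΓ t⟩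
  have hu : Continuous u := (continuous_endpoint.comp Γ.continuous).subtype_mk _
  have ha : a.endpoint ∈ U := by simpa using hΓ 0
  let u₀ : U := ⟨a.endpoint, ha⟩
  have hlift : ∀ {v v' : U} (γ : Path (v : X) v') (O : Set X), O ⊆ U → Set.range γ ⊆ O →
      ∃ δ : Path v v', δ.map hval = γ ∧ ∀ t, (δ t : X) ∈ O := by
    intro v v' γ O hO hγ
    refine ⟨⟨⟨fun t => ⟨γ t, hO (hγ ⟨t, rfl⟩)⟩, by fun_prop⟩, by simp, by simp⟩, ?_, ?_⟩
    · ext t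
      rfl
    · exact fun t => hγ ⟨t, rfl⟩
  have hmem := mem_basicSet_of_path hU Γ hΓ
  -- Each `Γ t` is reached from a by a path inside U, where r is defined.
  have hγ' : ∀ t, ∃ γ : Path u₀ (u t), Joins a (Γ t) (γ.map hval) := by
    intro t
    obtain ⟨γ, hγ, h⟩ := mem_basicSet_iff.1 (hmem t)
    obtain ⟨δ, hδ, -⟩ := hlift (v := u₀) (v' := u t) γ U subset_rfl hγ
    refine ⟨δ, ?_⟩
    rw [hδ]
    exact h
  choose γ hγ using hγ'
  -- The shadow of Γ over Z: the class of r ∘ γ_t. Applying unique path lifting in Z to this path is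
  -- the core of the argument.
  let g : I → PathClass Z (r u₀) := fun t =>
    (base Z (r u₀)).append ((γ t).map r.continuous)
  have hg : ∀ s t (δ : Path (u s) (u t)), Joins (Γ s) (Γ t) (δ.map hval) →
      Joins (g s) (g t) (δ.map r.continuous) := by
    intro s t δ hδ
    refine joins_append_append _ ?_
    suffices h : (((γ s).trans δ).map r.continuous).Homotopic ((γ t).map r.continuous) by
      rw [Path.map_trans] at h
      exact h
    -- The homotopy is known only in X; K moves it to the image of i ∘ r, and injectivity of i on
    -- path classes brings it back to Z.
    refine hi _ _ ?_
    have h₁ := (hγ s).trans hδ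
    have h₂ := h₁.homotopic (hγ t)
    have h₃ : (((γ s).trans δ).map hval).Homotopic ((γ t).map hval) := by
      rw [Path.map_trans]
      exact h₂
    exact (homotopic_map_iff_of_homotopy K _ _).2 h₃
  have hgc : Continuous g := by
    rw [continuous_iff_continuousAt]
    intro t
    refine ((hasBasis_nhds _).tendsto_right_iff).2 ?_
    rintro W ⟨hW, htW⟩
    -- A neighbourhood W in Z pulls back under r to an open subset of X; paths realizing Γ near t
    -- inside it have r-images in W.
    have hO : IsOpen (Subtype.val '' (r ⁻¹' W) : Set X) :=
      hU.isOpenMap_subtype_val _ (hW.preimage r.continuous)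
    have hO' : (Subtype.val '' (r ⁻¹' W) : Set X) ⊆ U := by
      rintro _ ⟨v, -, rfl⟩
      exact v.2
    have htO : (Γ t).endpoint ∈ (Subtype.val '' (r ⁻¹' W) : Set X) := ⟨u t, htW, rfl⟩
    filter_upwards [Γ.continuous.continuousAt.preimage_mem_nhds
      ((isOpen_basicSet hO htO).mem_nhds (mem_basicSet_self htO))] with s hs
    obtain ⟨δ, hδ, h⟩ := mem_basicSet_iff.1 hs
    obtain ⟨δ', hδ', hδ''⟩ := hlift (v := u t) (v' := u s) δ _ hO' hδ
    refine mem_basicSet_iff.2 ⟨δ'.map r.continuous, ?_, hg t s δ' (by rw [hδ']; exact h)⟩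
    rintro _ ⟨x, rfl⟩
    obtain ⟨v, hv, hv'⟩ := hδ'' x
    have : v = δ' x := Subtype.ext hv'
    rw [this] at hv
    exact hv
  let υ : Path (u 0) (u 1) := ⟨⟨u, hu⟩, rfl, rfl⟩
  -- The shadow is the standard lift of r ∘ u, so r(γ₀ · u) and r(γ₁) are homotopic in Z; pushing
  -- forward by i and using K gives γ₀ · u ≃ γ₁ in X.
  have h₁ := hZ _ (g 0) (g 1) ⟨⟨g, hgc⟩, rfl, rfl⟩
  have h₂ : Joins (g 0) (g 1) (υ.map r.continuous) := h₁.congr rfl rfl fun t => rfl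
  have h₃ := (joins_append (base Z (r u₀)) ((γ 0).map r.continuous)).trans h₂
  have h₄ := h₃.homotopic (joins_append (base Z (r u₀)) ((γ 1).map r.continuous))
  have h₅ : ((((γ 0).trans υ).map r.continuous).map i.continuous).Homotopic
      (((γ 1).map r.continuous).map i.continuous) := by
    rw [Path.map_trans]
    exact Path.Homotopic.map h₄ i
  have h₆ := (homotopic_map_iff_of_homotopy K ((γ 0).trans υ) (γ 1)).1 h₅
  have h₇ : Joins a (Γ 1) (((γ 0).map hval).trans (υ.map hval)) := by
    rw [← Path.map_trans]
    exact (hγ 1).of_homotopic h₆.symm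
  exact ((hγ 0).of_trans h₇).congr Γ.source Γ.target fun t => rfl

end PathClass

/-! ### Concatenation over unit intervals and segments of the line -/

section glue

variable {Y Z : Type*}

/-- The map on `Y × ℝ` that is given by `B n` on `Y × [n, n + 1]`. -/
noncomputable def glueUnit (B : ℕ → Y × I → Z) (p : Y × ℝ) : Z :=
  B ⌊p.2⌋₊ (p.1, Set.projIcc 0 1 zero_le_one (p.2 - ⌊p.2⌋₊))

theorem glueUnit_nat_add {B : ℕ → Y × I → Z} (hB : ∀ n y, B n (y, 1) = B (n + 1) (y, 0))
    (n : ℕ) (y : Y) (s : I) : glueUnit B (y, n + s) = B n (y, s) := by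
  rcases eq_or_lt_of_le s.2.2 with h | h
  -- At the right end of the n-th piece the floor has already jumped to n + 1, so the matching
  -- condition `hB` is needed.
  · have hs : s = 1 := Subtype.ext h
    subst hs
    have : ⌊(n : ℝ) + (1 : I)⌋₊ = n + 1 := by
      rw [show ((n : ℝ) + (1 : I)) = ((n + 1 : ℕ) : ℝ) by push_cast; rfl, Nat.floor_natCast]
    simp only [glueUnit, this, hB]
    congr 2
    rw [Set.projIcc_of_le_left]
    · rfl
    · push_cast
      simp
  · have : ⌊(n : ℝ) + s⌋₊ = n := by
      rw [Nat.floor_eq_iff (by have := s.2.1; positivity)]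
      exact ⟨by linarith [s.2.1], by linarith⟩
    simp only [glueUnit, this, add_sub_cancel_left, Set.projIcc_val]

theorem glueUnit_nat (B : ℕ → Y × I → Z) (n : ℕ) (y : Y) :
    glueUnit B (y, n) = B n (y, 0) := by
  simp only [glueUnit, Nat.floor_natCast, sub_self]
  rw [Set.projIcc_of_le_left _ le_rfl]
  rfl

theorem continuous_glueUnit [TopologicalSpace Y] [TopologicalSpace Z] {B : ℕ → Y × I → Z}
    (hc : ∀ n, Continuous (B n)) (hB : ∀ n y, B n (y, 1) = B (n + 1) (y, 0)) :
    Continuous (glueUnit B) := by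
  have hpiece : ∀ n : ℕ, Continuous fun p : Y × ℝ =>
      B n (p.1, Set.projIcc 0 1 zero_le_one (p.2 - n)) := fun n =>
    (hc n).comp (continuous_fst.prodMk (continuous_projIcc.comp (by fun_prop)))
  rw [continuous_iff_continuousAt]
  rintro ⟨y, t⟩
  rcases h : ⌊t⌋₊ with _ | n
  -- For negative arguments too the floor is 0, and `projIcc` clamps, so piece 0 describes the map
  -- on all of t < 1.
  · have ht : t < 1 := Nat.floor_eq_zero.1 h
    refine (hpiece 0).continuousAt.congr ?_
    filter_upwards [(isOpen_Iio.preimage continuous_snd).mem_nhds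
      (show (y, t) ∈ Prod.snd ⁻¹' Set.Iio (1 : ℝ) from ht)] with p hp
    have : ⌊p.2⌋₊ = 0 := Nat.floor_eq_zero.2 hp
    simp [glueUnit, this]
  · have ht := (Nat.floor_eq_iff' n.succ_ne_zero).1 h
    push_cast at ht
    -- On (n, n + 2) the floor takes only the values n and n + 1, so the glued map is this two-piece
    -- map there.
    have hcont : Continuous fun p : Y × ℝ => if p.2 ≤ (n + 1 : ℝ) then
        B n (p.1, Set.projIcc 0 1 zero_le_one (p.2 - n)) else
        B (n + 1) (p.1, Set.projIcc 0 1 zero_le_one (p.2 - (n + 1 : ℕ))) := by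
      refine Continuous.if_le (hpiece n) (hpiece (n + 1)) continuous_snd continuous_const ?_
      intro p hp
      rw [hp, Set.projIcc_of_right_le _ (by linarith), Set.projIcc_of_le_left _ (by push_cast; linarith)]
      exact hB n p.1
    refine hcont.continuousAt.congr ?_
    filter_upwards [(isOpen_Ioo.preimage continuous_snd).mem_nhds
      (show (y, t) ∈ Prod.snd ⁻¹' Set.Ioo (n : ℝ) (n + 2) from
        ⟨by simp only; linarith, by simp only; linarith⟩)] with p hp
    obtain ⟨hp₁, hp₂⟩ := hp
    rcases lt_trichotomy p.2 (n + 1 : ℝ) with hlt | heq | hgt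
    · have : ⌊p.2⌋₊ = n := (Nat.floor_eq_iff (by linarith [(Nat.cast_nonneg n : (0 : ℝ) ≤ n)])).2
        ⟨hp₁.le, hlt⟩
      simp [glueUnit, this, hlt.le]
    · have : ⌊p.2⌋₊ = n + 1 := by rw [heq]; exact_mod_cast Nat.floor_natCast (n + 1)
      rw [if_pos heq.le]
      simp only [glueUnit, this]
      rw [heq, Set.projIcc_of_right_le _ (by linarith),
        Set.projIcc_of_le_left _ (by push_cast; linarith)]
      exact hB n p.1
    · have : ⌊p.2⌋₊ = n + 1 := (Nat.floor_eq_iff (by linarith [(Nat.cast_nonneg n : (0 : ℝ) ≤ n)])).2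
        ⟨by push_cast; linarith, by push_cast; linarith⟩
      simp only [glueUnit, this, if_neg hgt.not_ge]

end glue

section segment

variable {Z : Type*} [TopologicalSpace Z]

/-- The restriction of a map on the real line to the oriented segment from `s` to `t`. -/
def segmentPath (φ : C(ℝ, Z)) (s t : ℝ) : Path (φ s) (φ t) :=
  Path.map ⟨⟨fun u : I => s + u * (t - s), by fun_prop⟩, by simp, by simp⟩ φ.continuous

theorem segmentPath_apply (φ : C(ℝ, Z)) (s t : ℝ) (u : I) :
    segmentPath φ s t u = φ (s + u * (t - s)) := rfl

theorem segmentPath_trans_homotopic (φ : C(ℝ, Z)) (s t v : ℝ) :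
    ((segmentPath φ s t).trans (segmentPath φ t v)).Homotopic (segmentPath φ s v) := by
  unfold segmentPath
  rw [← Path.map_trans]
  exact Path.Homotopic.map (SimplyConnectedSpace.paths_homotopic _ _) φ

end segment

/-! ### Unique path lifting for locally retractable metric spaces -/

/-- A metric space such that small neighbourhoods of each point extend to self-maps of the space
with small range. -/
def IsLocallyRetractable (Z : Type*) [MetricSpace Z] : Prop :=
  ∀ (x : Z), ∀ ε > 0, ∃ δ > 0, ∃ R : C(Z, Z),
    (∀ z ∈ Metric.ball x δ, R z = z) ∧ ∀ z, R z ∈ Metric.ball x ε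

/-- By a Lebesgue number, a δ-ball around x lies in the fixed ball of some retraction centred at y
within ε/2 of x; its image of radius ε/2 around y is then within ε of x. -/
theorem IsLocallyRetractable.uniform {Z : Type*} [MetricSpace Z] (hZ : IsLocallyRetractable Z)
    {K : Set Z} (hK : IsCompact K) {ε : ℝ} (hε : 0 < ε) :
    ∃ δ > 0, ∀ x ∈ K, ∃ R : C(Z, Z),
      (∀ z ∈ Metric.ball x δ, R z = z) ∧ ∀ z, R z ∈ Metric.ball x ε := by
  choose d hd R hR hR' using fun x => hZ x (ε / 2) (half_pos hε)
  obtain ⟨δ, hδ, h⟩ := lebesgue_number_lemma_of_metric hK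
    (c := fun x => Metric.ball x (min (d x) (ε / 2))) (fun _ => Metric.isOpen_ball)
    (fun x _ => Set.mem_iUnion.2 ⟨x, Metric.mem_ball_self (lt_min (hd x) (half_pos hε))⟩)
  refine ⟨δ, hδ, fun x hx => ?_⟩
  obtain ⟨y, hy⟩ := h x hx
  refine ⟨R y, fun z hz => hR y z (Metric.ball_subset_ball (min_le_left _ _) (hy hz)), fun z => ?_⟩
  have h₁ := hR' y z
  have h₂ := Metric.ball_subset_ball (min_le_right _ _) (hy (Metric.mem_ball_self hδ))
  rw [Metric.mem_ball] at *
  rw [dist_comm] at h₂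
  linarith [dist_triangle (R y z) y x]

namespace PathClass

variable {Z : Type*} [MetricSpace Z] {z₀ : Z}

theorem uniform_mem_basicSet {a b : PathClass Z z₀} (Γ : Path a b) {δ : ℝ} (hδ : 0 < δ) :
    ∃ η > 0, ∀ s t : ℝ, dist s t < η →
      Γ.extend s ∈ (Γ.extend t).basicSet (Metric.ball (Γ.extend t).endpoint δ) := by
  have hmem : ∀ c : PathClass Z z₀, c.endpoint ∈ Metric.ball c.endpoint (δ / 2) :=
    fun c => Metric.mem_ball_self (half_pos hδ)
  obtain ⟨η, hη, h⟩ := lebesgue_number_lemma_of_metric (isCompact_univ (X := I))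
    (c := fun τ => Γ ⁻¹' ((Γ τ).basicSet (Metric.ball (Γ τ).endpoint (δ / 2))))
    (fun τ => (isOpen_basicSet Metric.isOpen_ball (hmem _)).preimage Γ.continuous)
    (fun τ _ => Set.mem_iUnion.2 ⟨τ, mem_basicSet_self (hmem _)⟩)
  refine ⟨η, hη, fun s t hst => ?_⟩
  obtain ⟨τ, hτ⟩ := h (Set.projIcc 0 1 zero_le_one t) trivial
  have h₁ := hτ (Metric.mem_ball_self hη)
  have h₂ := @hτ (Set.projIcc 0 1 zero_le_one s) (by
    rw [Metric.mem_ball]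
    refine lt_of_le_of_lt ?_ hst
    rw [Subtype.dist_eq, Real.dist_eq, Real.dist_eq]
    exact Set.abs_projIcc_sub_projIcc zero_le_one)
  have h₃ := mem_basicSet_trans (mem_basicSet_symm h₁) h₂
  refine basicSet_mono ?_ h₃
  have h₄ := endpoint_mem_of_mem_basicSet h₁
  intro x hx
  rw [Metric.mem_ball] at *
  rw [dist_comm] at h₄
  have := dist_triangle x (Γ τ).endpoint (Γ (Set.projIcc 0 1 zero_le_one t)).endpoint
  change dist x (Γ (Set.projIcc 0 1 zero_le_one t)).endpoint < δ
  linarith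

/-- A subdivision of a path of path classes into steps that are realized by paths of size
less than `r`. -/
structure Subdivision (G : ℝ → PathClass Z z₀) (r : ℝ) (M : ℕ) where
  path : ∀ i : ℕ, Path (G (i / M)).endpoint (G ((i + 1 : ℕ) / M)).endpoint
  joins : ∀ i, Joins _ _ (path i)
  dist_path_lt : ∀ i u, dist (path i u) (G (i / M)).endpoint < r
  dist_lt : ∀ s t, dist s t ≤ 1 / M → dist (G s).endpoint (G t).endpoint < r

namespace Subdivision

variable {G : ℝ → PathClass Z z₀} {r : ℝ} {M : ℕ}

/-- The concatenation of the paths of a subdivision. -/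
noncomputable def map (S : Subdivision G r M) : C(ℝ, Z) where
  toFun t := glueUnit (fun i p => S.path i p.2) ((), M * t)
  continuous_toFun := (continuous_glueUnit (fun i => by fun_prop) (fun i _ => by simp)).comp
    (by fun_prop : Continuous fun t : ℝ => ((), M * t))

theorem map_apply (S : Subdivision G r M) (hM : 0 < M) (i : ℕ) (u : I) :
    S.map ((i + u) / M) = S.path i u := by
  have h : (M : ℝ) * ((i + u) / M) = i + u := by field_simp
  change glueUnit (fun i p => S.path i p.2) ((), M * ((i + u) / M)) = _
  rw [h, glueUnit_nat_add (fun i _ => by simp)]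

theorem map_node (S : Subdivision G r M) (hM : 0 < M) (i : ℕ) :
    S.map (i / M) = (G (i / M)).endpoint := by
  have := S.map_apply hM i 0
  simpa using this

theorem joins_map (S : Subdivision G r M) (hM : 0 < M) (i n : ℕ) :
    Joins (G (i / M)) (G ((i + n : ℕ) / M)) ((segmentPath S.map (i / M) ((i + n : ℕ) / M)).cast
      (S.map_node hM i).symm (S.map_node hM (i + n)).symm) := by
  induction n with
  | zero =>
    refine (Joins.refl _).congr rfl (by simp) fun t => ?_
    change (G (i / M)).endpoint = S.map _
    simp [S.map_node hM]
  | succ n ih =>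
    have h₁ : Joins (G ((i + n : ℕ) / M)) (G ((i + (n + 1) : ℕ) / M))
        ((segmentPath S.map ((i + n : ℕ) / M) ((i + (n + 1) : ℕ) / M)).cast
          (S.map_node hM (i + n)).symm (S.map_node hM (i + (n + 1))).symm) := by
      refine (S.joins (i + n)).congr rfl rfl fun t => ?_
      rw [← S.map_apply hM]
      refine Eq.trans ?_ (segmentPath_apply S.map _ _ t).symm
      congr 1
      push_cast
      field_simp
      ring
    refine (ih.trans h₁).of_homotopic ?_
    exact (segmentPath_trans_homotopic S.map (i / M) ((i + n : ℕ) / M)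
      ((i + (n + 1) : ℕ) / M)).pathCast (S.map_node hM i).symm (S.map_node hM (i + (n + 1))).symm

theorem dist_map_lt (S : Subdivision G r M) (t : ℝ) :
    dist (S.map t) (G (⌊M * t⌋₊ / M)).endpoint < r :=
  S.dist_path_lt _ _

/-- A homotopy between consecutive approximations on one box. -/
theorem exists_box {r' δ ε : ℝ} {N : ℕ} (S : Subdivision G r M) (S' : Subdivision G r' (M * N))
    (hM : 0 < M) (hN : 0 < N) (hr : r + r' ≤ δ)
    (hR : ∀ t, ∃ R : C(Z, Z), (∀ z ∈ Metric.ball (G t).endpoint δ, R z = z) ∧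
      ∀ z, R z ∈ Metric.ball (G t).endpoint ε) (i : ℕ) :
    ∃ B : C(I × I, Z), (∀ u, B (0, u) = S.path i u) ∧ (∀ u : I, B (1, u) = S'.map ((i + u) / M)) ∧
      (∀ s, B (s, 0) = (G (i / M)).endpoint) ∧ (∀ s, B (s, 1) = (G ((i + 1 : ℕ) / M)).endpoint) ∧
      ∀ p, dist (B p) (G (i / M)).endpoint < ε := by
  have hM' : (0 : ℝ) < M := Nat.cast_pos.2 hM
  have hN' : (0 : ℝ) < N := Nat.cast_pos.2 hN
  have hMN : 0 < M * N := Nat.mul_pos hM hN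
  have hnode : ∀ j : ℕ, ((j * N : ℕ) : ℝ) / (M * N : ℕ) = j / M := by
    intro j
    push_cast
    field_simp
  have hend : ∀ j : ℕ, S'.map (j / M) = (G (j / M)).endpoint := by
    intro j
    rw [← hnode, S'.map_node hMN]
  let γ : Path (G (i / M)).endpoint (G ((i + 1 : ℕ) / M)).endpoint :=
    (segmentPath S'.map (i / M) ((i + 1 : ℕ) / M)).cast (hend i).symm (hend (i + 1)).symm
  have hγ : ∀ u : I, γ u = S'.map ((i + u) / M) := by
    intro u
    refine (segmentPath_apply S'.map _ _ u).trans ?_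
    congr 1
    push_cast
    field_simp
    ring
  have hj : Joins (G (i / M)) (G ((i + 1 : ℕ) / M)) γ := by
    refine (S'.joins_map hMN (i * N) N).congr (by rw [hnode]) ?_ fun t => ?_
    · rw [← Nat.succ_mul, hnode]
    · change S'.map _ = S'.map _
      rw [← Nat.succ_mul, hnode, hnode]
  -- The coarse step and the fine subpath connect the same two path classes, hence are homotopic,
  -- possibly by a large homotopy. Composing with R makes it small without moving the boundary,
  -- which lies in the δ-ball fixed by R.
  obtain ⟨H⟩ := (S.joins i).homotopic hj
  obtain ⟨R, hR, hR'⟩ := hR (i / M)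
  have hR₀ : ∀ u, R (S.path i u) = S.path i u := fun u =>
    hR _ (by rw [Metric.mem_ball]; linarith [S.dist_path_lt i u, (dist_nonneg.trans_lt (S'.dist_map_lt 0))])
  have hR₁ : ∀ u, R (γ u) = γ u := by
    intro u
    refine hR _ ?_
    rw [hγ, Metric.mem_ball]
    have hu₀ : (0 : ℝ) ≤ u := u.2.1
    have hu₁ : (u : ℝ) ≤ 1 := u.2.2
    set t : ℝ := (i + u) / M with ht
    have hMt : ((M * N : ℕ) : ℝ) * t = N * (i + u) := by
      rw [ht]
      push_cast
      field_simp
    -- The last fine node not after t; it lies in the i-th coarse interval, so its point is within r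
    -- of the coarse node, while the fine path is within r' of it. This is where r + r' ≤ δ enters.
    set j := ⌊((M * N : ℕ) : ℝ) * t⌋₊ with hj
    have hj₁ : ((i * N : ℕ) : ℝ) ≤ j := by
      refine Nat.cast_le.2 (Nat.le_floor ?_)
      rw [hMt]
      push_cast
      nlinarith
    have hj₂ : (j : ℝ) ≤ (i + 1) * N := by
      refine (Nat.floor_le (by rw [hMt]; positivity)).trans ?_
      rw [hMt]
      nlinarith
    push_cast at hj₁
    have hk : dist (j / (M * N : ℕ) : ℝ) (i / M) ≤ 1 / M := by
      rw [Real.dist_eq, abs_of_nonneg]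
      · rw [sub_le_iff_le_add, ← add_div]
        push_cast
        rw [div_le_div_iff₀ (by positivity) hM']
        nlinarith
      · rw [sub_nonneg]
        push_cast
        rw [div_le_div_iff₀ hM' (by positivity)]
        nlinarith
    have hd := S'.dist_map_lt t
    rw [← hj] at hd
    linarith [dist_triangle (S'.map t) (G (j / (M * N : ℕ))).endpoint
      (G (i / M)).endpoint, S.dist_lt _ _ hk]
  refine ⟨R.comp ⟨H, H.continuous⟩, fun u => ?_, fun u => ?_, fun s => ?_, fun s => ?_,
    fun p => hR' _⟩
  · simp [hR₀]
  · simpa [hγ] using hR₁ u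
  · simpa using hR₀ 0
  · simpa using hR₀ 1

end Subdivision

end PathClass

/-- Consecutive homotopies that converge uniformly can be concatenated. -/
theorem exists_limit_homotopy {Z : Type*} [MetricSpace Z] (f : C(I, Z)) (H : ℕ → C(I × I, Z))
    (hH : ∀ k t, H k (1, t) = H (k + 1) (0, t)) {e : ℕ → ℝ} (he : Filter.Tendsto e .atTop (𝓝 0))
    (hd : ∀ k p, dist (H k p) (f p.2) ≤ e k) :
    ∃ L : C(I × I, Z), (∀ t, L (0, t) = H 0 (0, t)) ∧ (∀ t, L (1, t) = f t) ∧
      ∀ t, (∀ k s, H k (s, t) = f t) → ∀ s, L (s, t) = f t := by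
  classical
  let T : I × ℝ → Z := glueUnit fun k p => H k (p.2, p.1)
  have hT : Continuous T := continuous_glueUnit (fun k => by fun_prop) fun k t => hH k t
  have hTd : ∀ (n : ℕ) (t : I) (x : ℝ), (∀ k ≥ n, ∀ p, dist (H k p) (f p.2) ≤ e k) →
      (n : ℝ) ≤ x → ∃ k ≥ n, dist (T (t, x)) (f t) ≤ e k := fun n t x h hx =>
    ⟨⌊x⌋₊, Nat.le_floor hx, hd _ (_, t)⟩
  -- The substitution s ↦ s / (1 - s) stretches [0, 1) to [0, ∞), where the k-th homotopy occupies
  -- [k, k + 1]; the limit f is placed at s = 1.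
  let L : I × I → Z := fun p => if p.1 = 1 then f p.2 else T (p.2, p.1 / (1 - p.1))
  have hL₁ : ∀ t, L (1, t) = f t := fun t => if_pos rfl
  have hL : Continuous L := by
    rw [continuous_iff_continuousAt]
    rintro ⟨s, t⟩
    rcases eq_or_ne s 1 with rfl | hs
    · rw [Metric.continuousAt_iff']
      intro ε hε
      have h₁ := (he.eventually (gt_mem_nhds (half_pos hε))).exists_forall_of_atTop
      obtain ⟨n, hn⟩ := h₁
      -- For s < 1, this inequality says that s / (1 - s) > n, so that only homotopies of index at
      -- least n occur.
      have h₂ : ∀ᶠ p : I × I in 𝓝 (1, t), (n : ℝ) < p.1 * (n + 1) := by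
        have hc : Continuous fun p : I × I => (p.1 : ℝ) * (n + 1) := by fun_prop
        exact hc.continuousAt.eventually (lt_mem_nhds (by simp))
      have h₃ : ∀ᶠ p : I × I in 𝓝 (1, t), dist (f p.2) (f t) < ε / 2 := by
        have hc : Continuous fun p : I × I => f p.2 := by fun_prop
        exact (Metric.continuousAt_iff'.1 hc.continuousAt) _ (half_pos hε)
      filter_upwards [h₂, h₃] with p hp hp'
      rw [hL₁]
      rcases eq_or_ne p.1 1 with h | h
      · rw [show L p = f p.2 from if_pos h]
        linarith
      · rw [show L p = T (p.2, p.1 / (1 - p.1)) from if_neg h]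
        have hlt : (p.1 : ℝ) < 1 := lt_of_le_of_ne p.1.2.2 fun h' => h (Subtype.ext h')
        obtain ⟨k, hk, hk'⟩ := hTd n p.2 (p.1 / (1 - p.1)) (fun k _ => hd k) (by
          rw [le_div_iff₀ (by linarith)]
          linarith)
        linarith [dist_triangle (T (p.2, p.1 / (1 - p.1))) (f p.2) (f t), hn k hk]
    · have hlt : (s : ℝ) < 1 := lt_of_le_of_ne s.2.2 fun h' => hs (Subtype.ext h')
      have h₁ : ContinuousAt (fun p : I × I => T (p.2, p.1 / (1 - p.1))) (s, t) := by
        refine hT.continuousAt.comp (continuousAt_snd.prodMk ?_)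
        refine ContinuousAt.div (by fun_prop) (by fun_prop) ?_
        simp only
        linarith
      refine h₁.congr ?_
      have h₂ : ∀ᶠ p : I × I in 𝓝 (s, t), p.1 ≠ 1 := continuousAt_fst.eventually_ne hs
      filter_upwards [h₂] with p hp
      exact (if_neg hp).symm
  refine ⟨⟨L, hL⟩, fun t => ?_, hL₁, fun t ht s => ?_⟩
  · change L (0, t) = _
    have h₀ : L (0, t) = T (t, (0 : ℕ)) := by
      refine (if_neg (by simp)).trans ?_
      simp
    rw [h₀]
    exact glueUnit_nat _ _ _
  · change L (s, t) = _
    simp only [L]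
    split_ifs
    · rfl
    · exact ht _ _

namespace PathClass

variable {Z : Type*} [MetricSpace Z] {z₀ : Z}

theorem nonempty_subdivision {G : ℝ → PathClass Z z₀} {r : ℝ} {M : ℕ} (hM : 0 < M)
    (hG : ∀ s t, dist s t ≤ 1 / M → G s ∈ (G t).basicSet (Metric.ball (G t).endpoint r)) :
    Nonempty (Subdivision G r M) := by
  have hM' : (0 : ℝ) < M := Nat.cast_pos.2 hM
  have h : ∀ i : ℕ, ∃ γ : Path (G (i / M)).endpoint (G ((i + 1 : ℕ) / M)).endpoint,
      Set.range γ ⊆ Metric.ball (G (i / M)).endpoint r ∧ Joins _ _ γ := by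
    intro i
    refine mem_basicSet_iff.1 (hG _ _ (le_of_eq ?_))
    rw [Real.dist_eq, ← sub_div]
    push_cast
    rw [add_sub_cancel_left, abs_of_pos (by positivity)]
  choose γ hγ hγ' using h
  exact ⟨⟨γ, hγ', fun i u => hγ i ⟨u, rfl⟩, fun s t hst => endpoint_mem_of_mem_basicSet (hG s t hst)⟩⟩

/-- The strip between two consecutive approximations of a path. -/
theorem Subdivision.exists_strip {G : ℝ → PathClass Z z₀} {r r' δ ε : ℝ} {M N : ℕ}
    (S : Subdivision G r M) (S' : Subdivision G r' (M * N))
    (hM : 0 < M) (hN : 0 < N) (hr : r + r' ≤ δ)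
    (hR : ∀ t, ∃ R : C(Z, Z), (∀ z ∈ Metric.ball (G t).endpoint δ, R z = z) ∧
      ∀ z, R z ∈ Metric.ball (G t).endpoint ε) :
    ∃ H : C(I × I, Z), (∀ t : I, H (0, t) = S.map t) ∧ (∀ t : I, H (1, t) = S'.map t) ∧
      (∀ s, H (s, 0) = (G 0).endpoint) ∧ (∀ s, H (s, 1) = (G 1).endpoint) ∧
      ∀ p : I × I, dist (H p) (G p.2).endpoint ≤ ε + r := by
  have hM' : (0 : ℝ) < M := Nat.cast_pos.2 hM
  choose B hB₀ hB₁ hBl hBr hBd using S.exists_box S' hM hN hr hR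
  have hc : Continuous fun p : I × I => glueUnit (fun n => B n) (p.1, M * p.2) :=
    (continuous_glueUnit (fun n => (B n).continuous) fun n s => by rw [hBl, hBr]).comp
      (by fun_prop : Continuous fun p : I × I => (p.1, (M * p.2 : ℝ)))
  have hfl : ∀ t : I, (⌊M * (t : ℝ)⌋₊ : ℝ) ≤ M * t ∧ M * (t : ℝ) < ⌊M * (t : ℝ)⌋₊ + 1 :=
    fun t => ⟨Nat.floor_le (mul_nonneg hM'.le t.2.1), Nat.lt_floor_add_one _⟩
  refine ⟨⟨_, hc⟩, fun t => hB₀ _ _, fun t => ?_, fun s => ?_, fun s => ?_, fun p => ?_⟩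
  · refine (hB₁ _ _).trans ?_
    congr 1
    rw [Set.projIcc_of_mem zero_le_one
      ⟨sub_nonneg.2 (hfl t).1, by linarith [(hfl t).2]⟩]
    simp only
    field_simp
    ring
  · have := glueUnit_nat (fun n => B n) 0 s
    rw [hBl] at this
    simpa using this
  · have := glueUnit_nat (fun n => B n) M s
    rw [hBl, div_self hM'.ne'] at this
    simpa using this
  · have h₁ := hBd ⌊M * (p.2 : ℝ)⌋₊ (p.1, Set.projIcc 0 1 zero_le_one
      (M * (p.2 : ℝ) - ⌊M * (p.2 : ℝ)⌋₊))
    have h₂ := S.dist_lt (⌊M * (p.2 : ℝ)⌋₊ / M) p.2 (by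
      rw [dist_comm, Real.dist_eq, abs_of_nonneg]
      · rw [sub_le_iff_le_add, ← add_div, le_div_iff₀ hM']
        linarith [(hfl p.2).2]
      · rw [sub_nonneg, div_le_iff₀ hM']
        linarith [(hfl p.2).1])
    have h₃ := dist_triangle (glueUnit (fun n => B n) (p.1, (M * p.2 : ℝ)))
      (G (⌊M * (p.2 : ℝ)⌋₊ / M)).endpoint (G p.2).endpoint
    exact h₃.trans (add_le_add h₁.le h₂.le)

/-- The coarsest approximation of Γ joins a to b by concatenation of realizing paths, and the
infinite concatenation of the strips deforms it, relative to its ends, to the projection of Γ. -/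
theorem _root_.HawaiianPants.IsLocallyRetractable.hasUniquePathLifting
    (hZ : IsLocallyRetractable Z) (z₀ : Z) : HasUniquePathLifting Z z₀ := by
  intro a b Γ
  have hε : ∀ k : ℕ, (0 : ℝ) < 1 / (k + 1) := fun k => Nat.one_div_pos_of_nat
  have hK : IsCompact (Set.range fun t => (Γ t).endpoint) :=
    isCompact_range (continuous_endpoint.comp Γ.continuous)
  choose δ hδ hR using fun k => hZ.uniform hK (hε k)
  have hR' : ∀ k (t : ℝ), ∃ R : C(Z, Z),
      (∀ z ∈ Metric.ball (Γ.extend t).endpoint (δ k), R z = z) ∧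
        ∀ z, R z ∈ Metric.ball (Γ.extend t).endpoint (1 / (k + 1)) :=
    fun k t => hR k _ ⟨_, rfl⟩
  have hr : ∃ r : ℕ → ℝ, (∀ k, 0 < r k) ∧ (∀ k, r k ≤ 1 / (k + 1)) ∧
      ∀ k, r k + r (k + 1) ≤ δ k := by
    -- A decreasing sequence with r k ≤ min (δ k) (1/(k+1)) / 2, whence r k + r (k+1) ≤ 2 r k ≤ δ k.
    let r : ℕ → ℝ := fun k => Nat.rec (min (δ 0) (1 / ((0 : ℕ) + 1)) / 2)
      (fun k x => min x (min (δ (k + 1)) (1 / ((k + 1 : ℕ) + 1)) / 2)) k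
    have hr₁ : ∀ k, r k ≤ min (δ k) (1 / (k + 1)) / 2 := by
      rintro (_ | k)
      · exact le_rfl
      · exact min_le_right _ _
    have hr₂ : ∀ k, r (k + 1) ≤ r k := fun k => min_le_left _ _
    have hr₀ : ∀ k, 0 < r k := by
      intro k
      induction k with
      | zero => exact half_pos (lt_min (hδ 0) (hε 0))
      | succ k ih => exact lt_min ih (half_pos (lt_min (hδ _) (hε _)))
    refine ⟨r, hr₀, fun k => ?_, fun k => ?_⟩
    · linarith [hr₁ k, min_le_right (δ k) (1 / (k + 1)), hε k]
    · linarith [hr₁ k, hr₂ k, min_le_left (δ k) (1 / (k + 1))]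
  obtain ⟨r, hr₀, hrε, hrδ⟩ := hr
  choose η hη hG using fun k => uniform_mem_basicSet Γ (hr₀ k)
  choose n hn using fun k => exists_nat_one_div_lt (hη k)
  let N : ℕ → ℕ := fun k => n k + 1
  -- Products rather than independent mesh sizes, so that each subdivision refines the preceding
  -- one.
  let M : ℕ → ℕ := fun k => ∏ j ∈ Finset.range (k + 1), N j
  have hM : ∀ k, 0 < M k := fun k => Finset.prod_pos fun j _ => Nat.succ_pos _
  have hMs : ∀ k, M (k + 1) = M k * N (k + 1) := fun k => Finset.prod_range_succ _ _
  have hNM : ∀ k, N k ≤ M k := fun k =>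
    Nat.le_of_dvd (hM k) (Finset.dvd_prod_of_mem _ (Finset.self_mem_range_succ k))
  have hS : ∀ k, Nonempty (Subdivision Γ.extend (r k) (M k)) := by
    refine fun k => nonempty_subdivision (hM k) fun s t hst => hG k s t ?_
    refine hst.trans_lt (lt_of_le_of_lt ?_ (hn k))
    refine one_div_le_one_div_of_le (by positivity) ?_
    exact_mod_cast hNM k
  let S : ∀ k, Subdivision Γ.extend (r k) (M k) := fun k => (hS k).some
  have hstrip : ∀ k, ∃ H : C(I × I, Z), (∀ t : I, H (0, t) = (S k).map t) ∧
      (∀ t : I, H (1, t) = (S (k + 1)).map t) ∧ (∀ s, H (s, 0) = (Γ.extend 0).endpoint) ∧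
      (∀ s, H (s, 1) = (Γ.extend 1).endpoint) ∧
      ∀ p : I × I, dist (H p) (Γ.extend p.2).endpoint ≤ 1 / (k + 1) + r k := by
    intro k
    have key : ∀ (m : ℕ) (S' : Subdivision Γ.extend (r (k + 1)) m), m = M k * N (k + 1) →
        ∃ H : C(I × I, Z), (∀ t : I, H (0, t) = (S k).map t) ∧
          (∀ t : I, H (1, t) = S'.map t) ∧ (∀ s, H (s, 0) = (Γ.extend 0).endpoint) ∧
          (∀ s, H (s, 1) = (Γ.extend 1).endpoint) ∧
          ∀ p : I × I, dist (H p) (Γ.extend p.2).endpoint ≤ 1 / (k + 1) + r k := by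
      rintro m S' rfl
      exact (S k).exists_strip S' (hM k) (Nat.succ_pos _) (hrδ k) (hR' k)
    exact key _ (S (k + 1)) (hMs k)
  choose H hH₀ hH₁ hHl hHr hHd using hstrip
  let f : C(I, Z) := ⟨fun t => (Γ t).endpoint, continuous_endpoint.comp Γ.continuous⟩
  have hf : ∀ t : I, (Γ.extend t).endpoint = f t := fun t => by
    rw [Path.extend_apply Γ t.2]
    rfl
  obtain ⟨L, hL₀, hL₁, hLf⟩ := exists_limit_homotopy f H (fun k t => by rw [hH₁, hH₀])
    (e := fun k => 2 * (1 / ((k : ℝ) + 1)))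
    (by simpa using tendsto_one_div_add_atTop_nhds_zero_nat.const_mul (2 : ℝ))
    (fun k p => by
      have := hHd k p
      rw [hf] at this
      linarith [hrε k])
  have hj := (S 0).joins_map (hM 0) 0 (M 0)
  have hM₀ : ((M 0 : ℕ) : ℝ) ≠ 0 := Nat.cast_ne_zero.2 (hM 0).ne'
  have e₀ : Γ.extend ((0 : ℕ) / (M 0 : ℕ)) = a := by simp
  have e₁ : Γ.extend ((0 + M 0 : ℕ) / (M 0 : ℕ)) = b := by
    rw [zero_add, div_self hM₀, Path.extend_one]
  have hmap₀ : (S 0).map ((0 : I) : ℝ) = a.endpoint := by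
    rw [← hH₀, hHl, Path.extend_zero]
  have hmap₁ : (S 0).map ((1 : I) : ℝ) = b.endpoint := by
    rw [← hH₀, hHr, Path.extend_one]
  let P : Path a.endpoint b.endpoint :=
    ⟨⟨fun t : I => (S 0).map t, by fun_prop⟩, hmap₀, hmap₁⟩
  have hP : Joins a b P := by
    refine hj.congr e₀ e₁ fun t => ?_
    refine (segmentPath_apply (S 0).map _ _ t).trans ?_
    change _ = (S 0).map t
    congr 1
    rw [zero_add, div_self hM₀]
    simp
  refine hP.of_homotopic ⟨{
    toFun := L
    continuous_toFun := L.continuous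
    map_zero_left := fun t => by rw [hL₀, hH₀]; rfl
    map_one_left := fun t => hL₁ t
    prop' := ?_ }⟩
  rintro s t (rfl | rfl)
  · refine (hLf 0 (fun k s => ?_) s).trans ?_
    · rw [hHl, ← hf 0]
      rfl
    · simp [f]
  · refine (hLf 1 (fun k s => ?_) s).trans ?_
    · rw [hHr, ← hf 1]
      rfl
    · simp [f]

end PathClass

noncomputable section

/-! ## The Hawaiian Earring -/

/-- Inversion takes C_m minus the origin to the line Re w = m/2. The earring becomes a family of
parallel lines with the base point at infinity, and 2 Re(1/z) reads off the index. -/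
theorem mem_sphere_iff (m : ℕ+) {z : ℂ} (hz : z ≠ 0) :
    z ∈ Metric.sphere (((1 / m : ℝ) : ℂ)) (1 / m) ↔ 2 * (z⁻¹).re = m := by
  have hm : (0 : ℝ) < m := by exact_mod_cast m.pos
  have hz' : 0 < Complex.normSq z := Complex.normSq_pos.2 hz
  rw [mem_sphere_iff_norm, Complex.inv_re, ← sq_eq_sq₀ (norm_nonneg _) (by positivity),
    ← Complex.normSq_eq_norm_sq, Complex.normSq_sub]
  simp only [Complex.normSq_ofReal, Complex.conj_ofReal, Complex.re_mul_ofReal]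
  field_simp
  constructor
  · intro h
    nlinarith
  · intro h
    nlinarith

/-- The base point of the earring. -/
def origin : earring := ⟨0, Set.mem_iUnion.2 ⟨1, by simp⟩⟩

theorem mem_earring_of_inv {z : ℂ} (m : ℕ+) (h : 2 * (z⁻¹).re = m) : z ∈ earring := by
  rcases eq_or_ne z 0 with rfl | hz
  · exact origin.2
  · exact Set.mem_iUnion.2 ⟨m, (mem_sphere_iff m hz).2 h⟩

theorem exists_index (z : earring) (hz : (z : ℂ) ≠ 0) : ∃ m : ℕ+, 2 * ((z : ℂ)⁻¹).re = m := by
  obtain ⟨m, hm⟩ := Set.mem_iUnion.1 z.2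
  exact ⟨m, (mem_sphere_iff m hz).1 hm⟩

theorem ne_zero_of_index {z : ℂ} {m : ℕ+} (h : 2 * (z⁻¹).re = m) : z ≠ 0 := by
  rintro rfl
  have : (m : ℝ) ≠ 0 := by exact_mod_cast m.ne_zero
  rw [inv_zero, Complex.zero_re, mul_zero] at h
  exact this h.symm

theorem norm_le_of_index {z : ℂ} {m : ℕ+} (h : 2 * (z⁻¹).re = m) : ‖z‖ ≤ 2 / m := by
  have hm : (0 : ℝ) < m := by exact_mod_cast m.pos
  have h₁ := Complex.re_le_norm z⁻¹
  have h₂ : 0 < ‖z‖ := norm_pos_iff.2 (ne_zero_of_index h)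
  rw [norm_inv] at h₁
  have h₃ : (m : ℝ) / 2 ≤ ‖z‖⁻¹ := by linarith
  rw [le_inv_comm₀ (by positivity) h₂] at h₃
  simpa using h₃

theorem abs_im_inv_ge {z : ℂ} {m : ℕ+} (h : 2 * (z⁻¹).re = m) :
    ‖z‖⁻¹ - m / 2 ≤ |(z⁻¹).im| := by
  have hm : (0 : ℝ) < m := by exact_mod_cast m.pos
  have h₁ := Complex.norm_le_abs_re_add_abs_im z⁻¹
  rw [norm_inv, abs_of_nonneg (by linarith : 0 ≤ (z⁻¹).re)] at h₁
  linarith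

/-- Away from the base point 2 Re(1/z) is continuous and integer-valued on the earring. -/
theorem eventually_index_eq (z₀ : earring) (hz : (z₀ : ℂ) ≠ 0) {m : ℕ+}
    (hm : 2 * ((z₀ : ℂ)⁻¹).re = m) : ∀ᶠ z : earring in 𝓝 z₀, 2 * ((z : ℂ)⁻¹).re = m := by
  have hc : ContinuousAt (fun z : earring => 2 * ((z : ℂ)⁻¹).re) z₀ :=
    continuousAt_const.mul (Complex.continuous_re.continuousAt.comp
      (continuousAt_subtype_val.inv₀ hz))
  have h₁ := Metric.continuousAt_iff'.1 hc 1 one_pos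
  have h₂ : ∀ᶠ z : earring in 𝓝 z₀, (z : ℂ) ≠ 0 := continuousAt_subtype_val.eventually_ne hz
  filter_upwards [h₁, h₂] with z hz₁ hz₂
  obtain ⟨n, hn⟩ := exists_index z hz₂
  rw [hn, hm, Real.dist_eq] at hz₁
  rw [hn]
  have : |((n : ℤ) - (m : ℤ) : ℤ)| < 1 := by exact_mod_cast hz₁
  have h₃ := Int.abs_lt_one_iff.1 this
  have : (n : ℤ) = (m : ℤ) := by linarith
  exact_mod_cast this

/-- Continuity of a map on the earring can be checked at the base point and circle by circle. -/
theorem continuous_of_circles {Y : Type*} [TopologicalSpace Y] {F : earring → Y}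
    (h₀ : ContinuousAt F origin) (G : ℕ+ → ℂ → Y)
    (hFG : ∀ (m : ℕ+) (z : earring), 2 * ((z : ℂ)⁻¹).re = m → F z = G m z)
    (hG : ∀ (m : ℕ+) (z : earring), 2 * ((z : ℂ)⁻¹).re = m → ContinuousAt (G m) z) :
    Continuous F := by
  rw [continuous_iff_continuousAt]
  intro z
  rcases eq_or_ne (z : ℂ) 0 with hz | hz
  · have : z = origin := Subtype.ext hz
    rwa [this]
  · obtain ⟨m, hm⟩ := exists_index z hz
    refine ((hG m z hm).comp continuousAt_subtype_val).congr ?_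
    filter_upwards [eventually_index_eq z hz hm] with z' hz'
    exact (hFG m z' hz').symm

/-! ### Small retractions near the base point -/

/-- A function that is `1 / y` for `|y| ≥ Y` and bounded by `1 / Y`. -/
def truncInv (Y y : ℝ) : ℝ := y / max (y ^ 2) (Y ^ 2)

theorem continuous_truncInv {Y : ℝ} (hY : 0 < Y) : Continuous (truncInv Y) :=
  continuous_id.div (by fun_prop) fun y => (lt_max_of_lt_right (by positivity)).ne'

theorem abs_truncInv_le {Y : ℝ} (hY : 0 < Y) (y : ℝ) : |truncInv Y y| ≤ 1 / Y := by
  have hpos : 0 < max (y ^ 2) (Y ^ 2) := lt_max_of_lt_right (by positivity)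
  rw [truncInv, abs_div, abs_of_pos hpos, div_le_div_iff₀ hpos hY, one_mul]
  rcases le_total |y| Y with h | h
  · refine le_max_of_le_right ?_
    nlinarith
  · refine le_max_of_le_left ?_
    rw [← sq_abs y]
    nlinarith [abs_nonneg y]

theorem truncInv_eq {Y y : ℝ} (hY : 0 < Y) (h : Y ≤ |y|) : truncInv Y y = y⁻¹ := by
  have hy : y ≠ 0 := by
    rintro rfl
    simp at h
    linarith
  rw [truncInv, max_eq_left]
  · field_simp
  · rw [← sq_abs y]
    nlinarith

/-- The point of the circle with inverse on the line `Re = x` that has parameter `t`. -/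
def foldPt (x t : ℝ) : ℂ := t / (x * t + Complex.I)

theorem foldPt_den_ne (x t : ℝ) : (x * t + Complex.I : ℂ) ≠ 0 := by
  intro h
  have := congrArg Complex.im h
  simp at this

theorem norm_foldPt_le (x t : ℝ) : ‖foldPt x t‖ ≤ |t| := by
  have h : 1 ≤ ‖(x * t + Complex.I : ℂ)‖ := by
    have := Complex.abs_im_le_norm (x * t + Complex.I : ℂ)
    simpa using this
  rw [foldPt, norm_div, Complex.norm_real, Real.norm_eq_abs]
  exact div_le_self (abs_nonneg _) h

/-- For t ≠ 0 the point is the inverse of m/2 + i/t on the line of C_m, and t = 0 gives the base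
point at infinity. -/
theorem foldPt_mem (m : ℕ+) (t : ℝ) : foldPt (m / 2) t ∈ earring := by
  rcases eq_or_ne t 0 with rfl | ht
  · have : foldPt (m / 2) 0 = 0 := by simp [foldPt]
    rw [this]
    exact origin.2
  · refine mem_earring_of_inv m ?_
    have : (foldPt (m / 2) t)⁻¹ = ((m / 2 : ℝ) : ℂ) + (t⁻¹ : ℝ) * Complex.I := by
      have := foldPt_den_ne (m / 2) t
      have ht' : (t : ℂ) ≠ 0 := by exact_mod_cast ht
      rw [foldPt, inv_div]
      push_cast
      field_simp
    rw [this]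
    simp
    ring

theorem foldPt_inv_im {z : ℂ} (him : (z⁻¹).im ≠ 0) :
    foldPt (z⁻¹).re (z⁻¹).im⁻¹ = z := by
  obtain ⟨w, rfl⟩ : ∃ w : ℂ, z = w⁻¹ := ⟨z⁻¹, (inv_inv z).symm⟩
  rw [inv_inv] at *
  have h : (w.re : ℂ) + w.im * Complex.I = w := Complex.re_add_im w
  have him' : (w.im : ℂ) ≠ 0 := by exact_mod_cast him
  have hw : w ≠ 0 := fun h => him (by rw [h]; rfl)
  rw [foldPt, div_eq_iff (foldPt_den_ne _ _)]
  push_cast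
  have h₂ : (w.re : ℂ) * (w.im : ℂ)⁻¹ + Complex.I = w * (w.im : ℂ)⁻¹ := by
    nth_rw 3 [← h]
    field_simp
  rw [h₂, inv_mul_cancel_left₀ hw]

/-- Circles of index above N lie in the ε-ball and stay fixed. On each of the finitely many others
the far arc is folded back, the antipode of the base point going to the base point. -/
theorem exists_retraction_origin {ε : ℝ} (hε : 0 < ε) :
    ∃ δ > 0, ∃ R : C(earring, earring), (∀ z ∈ Metric.ball origin δ, R z = z) ∧
      ∀ z, R z ∈ Metric.ball origin ε := by
  classical
  obtain ⟨N, hN⟩ := exists_nat_gt (2 / ε)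
  have hN' : (0 : ℝ) < N := lt_trans (by positivity) hN
  set Y : ℝ := 2 / ε with hYdef
  have hY : 0 < Y := by positivity
  have hYε : 1 / Y < ε := by rw [hYdef, one_div_div]; linarith
  -- By the convention 0⁻¹ = 0 the base point falls into the first branch and is fixed.
  let Q : earring → ℂ := fun z =>
    if 2 * ((z : ℂ)⁻¹).re ≤ N then foldPt ((z : ℂ)⁻¹).re (truncInv Y ((z : ℂ)⁻¹).im) else z
  have hQ₀ : Q origin = 0 := by simp [Q, origin, truncInv, foldPt]
  have hQm : ∀ z : earring, Q z ∈ earring := by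
    intro z
    rcases eq_or_ne (z : ℂ) 0 with hz | hz
    · have : z = origin := Subtype.ext hz
      rw [this, hQ₀]
      exact origin.2
    · obtain ⟨m, hm⟩ := exists_index z hz
      simp only [Q]
      split_ifs
      · rw [show ((z : ℂ)⁻¹).re = m / 2 by linarith]
        exact foldPt_mem m _
      · exact z.2
  let R : earring → earring := fun z => ⟨Q z, hQm z⟩
  have hdist : ∀ z : earring, dist z origin = ‖(z : ℂ)‖ := fun z => by
    rw [Subtype.dist_eq]
    exact dist_zero_right _
  -- On a circle of index at most N, this radius forces |Im(1/z)| ≥ Y, where `truncInv` is honest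
  -- inversion.
  have hid : ∀ z ∈ Metric.ball origin (1 / (Y + N / 2)), R z = z := by
    intro z hz
    rw [Metric.mem_ball, hdist] at hz
    refine Subtype.ext ?_
    rcases eq_or_ne (z : ℂ) 0 with hz₀ | hz₀
    · have : z = origin := Subtype.ext hz₀
      rw [this]
      exact hQ₀
    · obtain ⟨m, hm⟩ := exists_index z hz₀
      change Q z = z
      simp only [Q]
      split_ifs with hle
      · have h₁ := abs_im_inv_ge hm
        have h₂ : Y + N / 2 < ‖(z : ℂ)‖⁻¹ := by
          rw [lt_inv_comm₀ (by positivity) (norm_pos_iff.2 hz₀)]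
          simpa using hz
        have h₃ : Y ≤ |((z : ℂ)⁻¹).im| := by linarith
        rw [truncInv_eq hY h₃]
        refine foldPt_inv_im fun h => ?_
        rw [h] at h₃
        simp at h₃
        linarith
      · rfl
  have hball : Metric.ball origin (1 / (Y + N / 2)) ∈ 𝓝 origin :=
    Metric.ball_mem_nhds _ (by positivity)
  have hR : Continuous R := by
    refine Continuous.subtype_mk (continuous_of_circles ?_ (fun m z => if (m : ℝ) ≤ N then
      foldPt (z⁻¹).re (truncInv Y (z⁻¹).im) else z) ?_ ?_) _
    · refine continuousAt_subtype_val.congr ?_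
      filter_upwards [hball] with z hz
      exact congrArg Subtype.val (hid z hz).symm
    · intro m z hm
      simp only [Q]
      rw [hm]
    · intro m z hm
      have hz := ne_zero_of_index hm
      split_ifs
      · have hi : ContinuousAt (fun z : ℂ => z⁻¹) z := continuousAt_id.inv₀ hz
        have h₁ : ContinuousAt (fun z : ℂ => (z⁻¹).re) z :=
          Complex.continuous_re.continuousAt.comp hi
        have h₂ : ContinuousAt (fun z : ℂ => truncInv Y (z⁻¹).im) z :=
          (continuous_truncInv hY).continuousAt.comp (Complex.continuous_im.continuousAt.comp hi)
        exact (Complex.continuous_ofReal.continuousAt.comp h₂).div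
          (((Complex.continuous_ofReal.continuousAt.comp h₁).mul
            (Complex.continuous_ofReal.continuousAt.comp h₂)).add continuousAt_const)
          (foldPt_den_ne _ _)
      · exact continuousAt_id
  refine ⟨1 / (Y + N / 2), by positivity, ⟨R, hR⟩, hid, fun z => ?_⟩
  rw [Metric.mem_ball, hdist]
  change ‖Q z‖ < ε
  rcases eq_or_ne (z : ℂ) 0 with hz₀ | hz₀
  · have : z = origin := Subtype.ext hz₀
    rw [this, hQ₀]
    simpa using hε
  · obtain ⟨m, hm⟩ := exists_index z hz₀
    simp only [Q]
    split_ifs with hle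
    · exact ((norm_foldPt_le _ _).trans (abs_truncInv_le hY _)).trans_lt hYε
    · refine (norm_le_of_index hm).trans_lt ?_
      rw [hm] at hle
      rw [div_lt_iff₀ (by linarith)]
      rw [hYdef, div_lt_iff₀ hε] at hN
      nlinarith

/-! ### Small retractions near the other points -/

/-- A compactly supported function that is the identity on `[-η, η]`. -/
def truncId (η s : ℝ) : ℝ := s * max 0 (min 1 (2 - |s| / η))

theorem continuous_truncId (η : ℝ) : Continuous (truncId η) := by
  unfold truncId
  fun_prop

theorem truncId_eq {η s : ℝ} (hη : 0 < η) (h : |s| ≤ η) : truncId η s = s := by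
  have : |s| / η ≤ 1 := (div_le_one hη).2 h
  rw [truncId, min_eq_left (by linarith), max_eq_right zero_le_one, mul_one]

theorem truncId_eq_zero {η s : ℝ} (hη : 0 < η) (h : 2 * η ≤ |s|) : truncId η s = 0 := by
  have : 2 ≤ |s| / η := (le_div_iff₀ hη).2 h
  rw [truncId, max_eq_left (min_le_of_right_le (by linarith)), mul_zero]

theorem abs_truncId_le {η : ℝ} (hη : 0 < η) (s : ℝ) : |truncId η s| ≤ 2 * η := by
  rcases le_total (2 * η) |s| with h | h
  · rw [truncId_eq_zero hη h, abs_zero]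
    linarith
  · rw [truncId, abs_mul, abs_of_nonneg (le_max_left (0 : ℝ) _)]
    refine le_trans ?_ h
    refine mul_le_of_le_one_right (abs_nonneg _) ?_
    exact max_le zero_le_one (min_le_left _ _)

/-- On the line of x the displacement from 1/x is truncated to compact support; all other circles go
to x. The truncation vanishes near infinity, so the map is constant near the base point. -/
theorem exists_retraction_of_ne (x : earring) (hx : (x : ℂ) ≠ 0) {ε : ℝ} (hε : 0 < ε) :
    ∃ δ > 0, ∃ R : C(earring, earring), (∀ z ∈ Metric.ball x δ, R z = z) ∧
      ∀ z, R z ∈ Metric.ball x ε := by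
  classical
  obtain ⟨m, hm⟩ := exists_index x hx
  obtain ⟨η', hη', hinv⟩ := Metric.continuousAt_iff.1
    (continuousAt_id.inv₀ (inv_ne_zero hx) : ContinuousAt (fun w : ℂ => w⁻¹) (x : ℂ)⁻¹) ε hε
  -- Truncated displacements are at most 2η, which is below the modulus of continuity η' of
  -- inversion at 1/x.
  set η : ℝ := η' / 4 with hηdef
  have hη : 0 < η := by positivity
  let q : ℂ → ℂ := fun z =>
    ((x : ℂ)⁻¹ + (truncId η ((z⁻¹).im - ((x : ℂ)⁻¹).im) : ℝ) * Complex.I)⁻¹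
  have hqre : ∀ t : ℝ, 2 * ((x : ℂ)⁻¹ + t * Complex.I).re = m := fun t => by simpa using hm
  have hq₀ : ∀ z : ℂ, 2 * η ≤ |(z⁻¹).im - ((x : ℂ)⁻¹).im| → q z = x := by
    intro z hz
    simp only [q, truncId_eq_zero hη hz]
    simp
  let Q : earring → ℂ := fun z => if 2 * ((z : ℂ)⁻¹).re = m then q z else x
  have hQm : ∀ z : earring, Q z ∈ earring := by
    intro z
    simp only [Q]
    split_ifs
    · refine mem_earring_of_inv m ?_
      rw [inv_inv]
      exact hqre _
    · exact x.2
  let R : earring → earring := fun z => ⟨Q z, hQm z⟩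
  have hR : Continuous R := by
    refine Continuous.subtype_mk (continuous_of_circles ?_
      (fun n z => if n = m then q z else x) ?_ ?_) _
    · refine (continuousAt_const : ContinuousAt (fun _ => (x : ℂ)) origin).congr ?_
      -- For |z| < 1/B on the circle of x, |Im(1/z)| exceeds |Im(1/x)| + 2η, so the truncation is
      -- zero.
      set B : ℝ := 2 * η + |((x : ℂ)⁻¹).im| + m / 2 with hB
      have hBpos : 0 < B := by positivity
      filter_upwards [Metric.ball_mem_nhds origin (show 0 < 1 / B by positivity)] with z hz
      simp only [Q]
      split_ifs with h
      · refine (hq₀ z ?_).symm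
        have hz₀ := ne_zero_of_index h
        have h₁ := abs_im_inv_ge h
        have h₂ : B < ‖(z : ℂ)‖⁻¹ := by
          rw [lt_inv_comm₀ hBpos (norm_pos_iff.2 hz₀)]
          rw [Metric.mem_ball, Subtype.dist_eq] at hz
          simpa [origin] using hz
        have h₃ := abs_sub_abs_le_abs_sub ((z : ℂ)⁻¹).im ((x : ℂ)⁻¹).im
        linarith
      · rfl
    · intro n z hn
      simp only [Q]
      rw [hn]
      simp only [Nat.cast_inj, PNat.coe_inj]
    · intro n z hn
      split_ifs with h
      · have hz := ne_zero_of_index hn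
        have hi : ContinuousAt (fun z : ℂ => z⁻¹) z := continuousAt_id.inv₀ hz
        have h₂ : ContinuousAt (fun z : ℂ => truncId η ((z⁻¹).im - ((x : ℂ)⁻¹).im)) z :=
          (continuous_truncId η).continuousAt.comp
            ((Complex.continuous_im.continuousAt.comp hi).sub continuousAt_const)
        refine ContinuousAt.inv₀ (continuousAt_const.add
          ((Complex.continuous_ofReal.continuousAt.comp h₂).mul continuousAt_const)) ?_
        intro h₀
        have := hqre (truncId η (((z : ℂ)⁻¹).im - ((x : ℂ)⁻¹).im))
        have h₀' : (x : ℂ)⁻¹ + (truncId η (((z : ℂ)⁻¹).im - ((x : ℂ)⁻¹).im) : ℝ) * Complex.I = 0 := h₀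
        rw [h₀', Complex.zero_re, mul_zero] at this
        exact m.ne_zero (by exact_mod_cast this.symm)
      · exact continuousAt_const
  have hnear : ∀ᶠ z : earring in 𝓝 x, R z = z := by
    have hc : ContinuousAt (fun z : earring => ((z : ℂ)⁻¹).im) x :=
      Complex.continuous_im.continuousAt.comp (continuousAt_subtype_val.inv₀ hx)
    filter_upwards [eventually_index_eq x hx hm, Metric.continuousAt_iff'.1 hc η hη] with z h₁ h₂
    refine Subtype.ext ?_
    change Q z = z
    rw [Real.dist_eq] at h₂
    simp only [Q, if_pos h₁, q]
    rw [truncId_eq hη h₂.le, inv_eq_iff_eq_inv]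
    apply Complex.ext
    · linarith [hqre (((z : ℂ)⁻¹).im - ((x : ℂ)⁻¹).im)]
    · simp
  obtain ⟨δ, hδ, hδR⟩ := Metric.eventually_nhds_iff_ball.1 hnear
  refine ⟨δ, hδ, ⟨R, hR⟩, hδR, fun z => ?_⟩
  rw [Metric.mem_ball, Subtype.dist_eq]
  change dist (Q z) x < ε
  simp only [Q]
  split_ifs
  · have := hinv (x := (x : ℂ)⁻¹ + (truncId η (((z : ℂ)⁻¹).im - ((x : ℂ)⁻¹).im) : ℝ) * Complex.I) (by
      rw [dist_eq_norm, add_sub_cancel_left, norm_mul, Complex.norm_I, mul_one, Complex.norm_real,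
        Real.norm_eq_abs]
      have := abs_truncId_le hη (((z : ℂ)⁻¹).im - ((x : ℂ)⁻¹).im)
      linarith)
    simpa [q] using this
  · simpa using hε

theorem isLocallyRetractable_earring : IsLocallyRetractable earring := by
  intro x ε hε
  rcases eq_or_ne (x : ℂ) 0 with hx | hx
  · have : x = origin := Subtype.ext hx
    rw [this]
    exact exists_retraction_origin hε
  · exact exists_retraction_of_ne x hx hε

end

noncomputable section

/-! ### Radial maps onto the circles of the earring -/

open Classical in
/-- The direction of a complex number (with value `1` at `0`). -/
def unitDir (f : ℂ) : ℂ := if f = 0 then 1 else f / ‖f‖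

theorem norm_unitDir (f : ℂ) : ‖unitDir f‖ = 1 := by
  unfold unitDir
  split_ifs with h
  · simp
  · have : ‖f‖ ≠ 0 := norm_ne_zero_iff.2 h
    rw [norm_div, Complex.norm_real, norm_norm, div_self this]

theorem continuousAt_unitDir {f : ℂ} (hf : f ≠ 0) : ContinuousAt unitDir f := by
  have h : ContinuousAt (fun g : ℂ => g / ‖g‖) f :=
    continuousAt_id.div (by fun_prop) (by simpa using hf)
  refine h.congr ?_
  filter_upwards [isOpen_ne.mem_nhds hf] with g hg
  exact (if_neg hg).symm

theorem unitDir_mul {r : ℝ} (hr : 0 < r) (f : ℂ) : unitDir (r * f) = unitDir f := by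
  have hr' : (r : ℂ) ≠ 0 := by exact_mod_cast hr.ne'
  unfold unitDir
  rcases eq_or_ne f 0 with rfl | hf
  · simp
  · rw [if_neg (mul_ne_zero hr' hf), if_neg hf, norm_mul, Complex.norm_real, Real.norm_of_nonneg hr.le]
    push_cast
    rw [mul_div_mul_left _ _ hr']

theorem unitDir_of_norm_eq_one {f : ℂ} (hf : ‖f‖ = 1) : unitDir f = f := by
  have : f ≠ 0 := by
    rintro rfl
    simp at hf
  rw [unitDir, if_neg this, hf]
  simp

/-- The point in direction `f` of the circle with index `x`. -/
def radial (x : ℕ+) (f : ℂ) : earring :=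
  ⟨(1 + unitDir f) / x, Set.mem_iUnion.2 ⟨x, by
    have hx : (0 : ℝ) < x := by exact_mod_cast x.pos
    rw [mem_sphere_iff_norm]
    have : (1 + unitDir f) / x - ((1 / x : ℝ) : ℂ) = unitDir f / x := by
      push_cast
      ring
    rw [this, norm_div, norm_unitDir]
    simp⟩⟩

theorem continuousAt_radial (x : ℕ+) {f : ℂ} (hf : f ≠ 0) : ContinuousAt (radial x) f := by
  rw [Topology.IsInducing.subtypeVal.continuousAt_iff]
  exact (continuousAt_const.add (continuousAt_unitDir hf)).div_const _

theorem radial_mul (x : ℕ+) {r : ℝ} (hr : 0 < r) (f : ℂ) : radial x (r * f) = radial x f := by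
  unfold radial
  simp only [unitDir_mul hr]

theorem radial_neg_one (x : ℕ+) : radial x (-1) = origin := by
  refine Subtype.ext ?_
  simp [radial, origin, unitDir_of_norm_eq_one]

theorem circleLoop_sub (c : ℂ) (r : ℝ) (t : I) :
    circleLoop c r t - c = r * circleLoop 0 1 t := by
  simp [circleLoop]

/-- This turns the parametrized attaching maps into a direction formula: on each boundary circle,
attaching is `radial` applied to z minus the centre. -/
theorem radial_circleLoop (n : ℕ+) (c : ℂ) {r : ℝ} (hr : 0 < r) (t : I) :
    radial n (circleLoop c r t - c) = ell n t := by
  rw [circleLoop_sub, radial_mul n hr]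
  refine Subtype.ext ?_
  have h : ‖circleLoop 0 1 t‖ = 1 := by
    rw [← dist_zero_right]
    exact dist_circleLoop 0 zero_le_one t
  simp only [radial, ell, unitDir_of_norm_eq_one h]
  simp only [circleLoop]
  push_cast
  ring

theorem exists_circleLoop_eq (c : ℂ) {r : ℝ} (hr : 0 < r) {z : ℂ} (hz : dist z c = r) :
    ∃ t : I, circleLoop c r t = z := by
  have hr' : (r : ℂ) ≠ 0 := by exact_mod_cast hr.ne'
  set u : ℂ := -(z - c) / r with hu
  have hnorm : ‖u‖ = 1 := by
    rw [hu, norm_div, norm_neg, ← dist_eq_norm, hz, Complex.norm_real, Real.norm_of_nonneg hr.le,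
      div_self hr.ne']
  have hexp : Complex.exp (Complex.arg u * Complex.I) = u := by
    have := Complex.norm_mul_exp_arg_mul_I u
    rwa [hnorm, Complex.ofReal_one, one_mul] at this
  have key : ∀ t : I, Complex.exp (-(2 * Real.pi * (t : ℝ)) * Complex.I) = u →
      circleLoop c r t = z := by
    intro t ht
    rw [circleLoop, ht, hu]
    field_simp
    ring
  have hpi := Real.pi_pos
  have hpi' : (Real.pi : ℂ) ≠ 0 := by exact_mod_cast hpi.ne'
  have h₁ := Complex.neg_pi_lt_arg u
  have h₂ := Complex.arg_le_pi u
  -- The loop has angle -2πt with t in [0, 1], so a positive argument must first be shifted by a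
  -- full turn.
  rcases le_total (Complex.arg u) 0 with h | h
  · refine ⟨⟨-Complex.arg u / (2 * Real.pi), ?_, ?_⟩, key _ ?_⟩
    · exact div_nonneg (by linarith) (by positivity)
    · rw [div_le_one (by positivity)]
      linarith
    · refine Eq.trans (congrArg Complex.exp ?_) hexp
      push_cast
      field_simp
  · refine ⟨⟨1 - Complex.arg u / (2 * Real.pi), ?_, ?_⟩, key _ ?_⟩
    · rw [sub_nonneg, div_le_one (by positivity)]
      linarith
    · have : 0 ≤ Complex.arg u / (2 * Real.pi) := by positivity
      linarith
    · refine Eq.trans (congrArg Complex.exp ?_) ((Complex.exp_periodic.sub_eq _).trans hexp)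
      push_cast
      field_simp
      ring

/-- The circle with index `o` in direction `f`, or the base point if there is no index. -/
def radialOpt (o : Option ℕ+) (f : ℂ) : earring := o.elim origin fun x => radial x f

theorem continuousAt_radialOpt (o : Option ℕ+) {f : ℂ} (hf : f ≠ 0) :
    ContinuousAt (radialOpt o) f := by
  rcases o with _ | x
  · exact continuousAt_const
  · exact continuousAt_radial x hf

theorem radialOpt_neg_one (o : Option ℕ+) : radialOpt o (-1) = origin := by
  rcases o with _ | x
  · rfl
  · exact radial_neg_one x

/-! ### Relabelling the circles of the earring -/

/-- The index of the circle that contains a given point other than the base point. -/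
def index (z : ℂ) : ℕ+ := ⌊2 * (z⁻¹).re⌋₊.toPNat'

theorem index_eq {z : ℂ} {m : ℕ+} (h : 2 * (z⁻¹).re = m) : index z = m := by
  rw [index, h, Nat.floor_natCast]
  exact PNat.coe_toPNat' m

/-- The factor by which the circle with index `m` is scaled. -/
def scaleFactor (w : ℕ+ → Option ℕ+) (m : ℕ+) : ℝ := (w m).elim 0 fun x => m / x

theorem scaleFactor_mul_mem (w : ℕ+ → Option ℕ+) {z : ℂ} {m : ℕ+} (h : 2 * (z⁻¹).re = m) :
    scaleFactor w m * z ∈ earring := by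
  rcases hw : w m with _ | x
  · simp only [scaleFactor, hw, Option.elim_none, Complex.ofReal_zero, zero_mul]
    exact origin.2
  · refine mem_earring_of_inv x ?_
    have hm : (m : ℝ) ≠ 0 := by exact_mod_cast m.ne_zero
    simp only [scaleFactor, hw, Option.elim_some]
    rw [mul_inv, ← Complex.ofReal_inv, Complex.re_ofReal_mul, ← mul_assoc, mul_comm (2 : ℝ),
      mul_assoc, h]
    field_simp

/-- The map that scales the circle with index `m` to the one with index `w m`, or collapses it. -/
def relabel (w : ℕ+ → Option ℕ+) (z : earring) : earring :=
  ⟨scaleFactor w (index z) * z, by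
    rcases eq_or_ne (z : ℂ) 0 with hz | hz
    · rw [hz, mul_zero]
      exact origin.2
    · obtain ⟨m, hm⟩ := exists_index z hz
      rw [index_eq hm]
      exact scaleFactor_mul_mem w hm⟩

theorem relabel_origin (w : ℕ+ → Option ℕ+) : relabel w origin = origin := by
  refine Subtype.ext ?_
  simp [relabel, origin]

theorem scaleFactor_nonneg (w : ℕ+ → Option ℕ+) (m : ℕ+) : 0 ≤ scaleFactor w m := by
  unfold scaleFactor
  rcases w m with _ | x
  · exact le_rfl
  · simp only [Option.elim_some]
    positivity

/-- Continuity away from the base point is automatic; at the base point the bound |relabel w z| ≤ C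
|z| gives it. -/
theorem continuous_relabel {w : ℕ+ → Option ℕ+} {C : ℝ} (hC : ∀ m, scaleFactor w m ≤ C) :
    Continuous (relabel w) := by
  refine Continuous.subtype_mk (continuous_of_circles ?_ (fun m z => scaleFactor w m * z) ?_ ?_) _
  · have h₀ : ((scaleFactor w (index (origin : earring)) : ℂ) * (origin : earring) : ℂ) = 0 := by
      simp [origin]
    have hb : ∀ z : earring, ‖((scaleFactor w (index (z : ℂ)) : ℂ) * z : ℂ)‖ ≤ C * ‖(z : ℂ)‖ := by
      intro z
      rw [norm_mul, Complex.norm_real, Real.norm_of_nonneg (scaleFactor_nonneg _ _)]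
      exact mul_le_mul_of_nonneg_right (hC _) (norm_nonneg _)
    unfold ContinuousAt
    beta_reduce
    rw [h₀]
    refine squeeze_zero_norm hb ?_
    have hc : Continuous fun z : earring => C * ‖(z : ℂ)‖ := by fun_prop
    have := hc.tendsto origin
    simpa [origin] using this
  · intro m z hm
    rw [index_eq hm]
  · intro m z _
    fun_prop

theorem relabel_radial (w : ℕ+ → Option ℕ+) (m : ℕ+) (f : ℂ) :
    relabel w (radial m f) = radialOpt (w m) f := by
  have hm : (m : ℂ) ≠ 0 := by exact_mod_cast m.ne_zero
  rcases eq_or_ne (1 + unitDir f) 0 with h | h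
  · have h₁ : ∀ x, radial x f = origin := fun x => Subtype.ext (by simp [radial, origin, h])
    rw [h₁, relabel_origin]
    rcases w m with _ | x
    · rfl
    · exact (h₁ x).symm
  · have h₁ : ((radial m f : earring) : ℂ) ≠ 0 := div_ne_zero h hm
    have h₂ : 2 * (((radial m f : earring) : ℂ)⁻¹).re = m := by
      rw [← mem_sphere_iff m h₁, mem_sphere_iff_norm]
      have : ((radial m f : earring) : ℂ) - ((1 / m : ℝ) : ℂ) = unitDir f / m := by
        simp only [radial]
        push_cast
        ring
      rw [this, norm_div, norm_unitDir]
      simp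
    refine Subtype.ext ?_
    simp only [relabel, index_eq h₂, scaleFactor]
    rcases w m with _ | x
    · simp [radialOpt, origin]
    · have hx : (x : ℂ) ≠ 0 := by exact_mod_cast x.ne_zero
      simp only [radialOpt, Option.elim_some, radial]
      push_cast
      field_simp

theorem relabel_some (z : earring) : relabel some z = z := by
  refine Subtype.ext ?_
  simp [relabel, scaleFactor]

/-! ### Sheets and their labels -/

/-- The sheets of the covering space of the Hawaiian Pants. -/
abbrev Sheet : Type := Option (ℕ × Option ℕ+ × Bool)

/-- The label that the circle with index `m` carries on a sheet. -/
def sheetLabel : Sheet → ℕ+ → Option ℕ+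
  | none, m => some m
  | some (j, x, _), m => if (m : ℕ) ≤ j then x else none

/-- The label that the `k`-th boundary circle of a pair of pants carries on a sheet. -/
def pantsLabel (k : Fin 3) : Sheet → Option ℕ+
  | none => none
  | some (_, x, b) => if k = 0 then x else if k = 1 then cond b x none else cond b none x

/-- The index of the circle to which the `k`-th boundary circle of the `n`-th pair of pants is
attached. -/
def attachIndex (k : Fin 3) (n : ℕ+) : ℕ+ :=
  if k = 0 then n else if k = 1 then 2 * n else 2 * n + 1

/-- This is why a sheet has a cutoff j: only circles of index m ≤ j are scaled, by m/x ≤ j, so the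
scale factors are bounded. -/
theorem continuous_relabel_sheetLabel (s : Sheet) : Continuous (relabel (sheetLabel s)) := by
  rcases s with _ | ⟨j, x, b⟩
  · refine continuous_relabel (C := 1) fun m => ?_
    simp only [scaleFactor, sheetLabel, Option.elim_some]
    exact div_self_le_one _
  · refine continuous_relabel (C := j) fun m => ?_
    simp only [scaleFactor, sheetLabel]
    split_ifs with h
    · rcases x with _ | x
      · simp
      · simp only [Option.elim_some]
        have hx : (1 : ℝ) ≤ x := by exact_mod_cast (one_le : (1 : ℕ+) ≤ x)
        have hm : (m : ℝ) ≤ j := by exact_mod_cast h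
        exact (div_le_self (by positivity) hx).trans hm
    · simp

/-- Every cutoff at least m lets circle m carry the prescribed label. -/
theorem infinite_sheetLabel_fiber (m : ℕ+) (o : Option ℕ+) :
    Infinite {s : Sheet // sheetLabel s m = o} := by
  refine Infinite.of_injective (fun j : ℕ => ⟨some (m + j, o, true), ?_⟩) ?_
  · simp [sheetLabel]
  · intro i j h
    simpa using h

/-- The cutoff does not affect the labels on pants, hence is free; the Boolean is chosen so that
boundary circle k is one that does not collapse. -/
theorem infinite_pantsLabel_fiber (k : Fin 3) (o : Option ℕ+) :
    Infinite {s : Sheet // pantsLabel k s = o} := by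
  refine Infinite.of_injective (fun j : ℕ => ⟨some (j, o, decide (k ≠ 2)), ?_⟩) ?_
  · fin_cases k <;> simp [pantsLabel]
  · intro i j h
    simpa using h

/-- Corresponding fibres of u and v are countably infinite, hence in bijection. -/
theorem exists_perm_of_infinite_fibers {S A : Type*} [Countable S] (u v : S → A)
    (hu : ∀ a, Infinite {s // u s = a}) (hv : ∀ a, Infinite {s // v s = a}) :
    ∃ e : Equiv.Perm S, ∀ s, v (e s) = u s := by
  have h : ∀ a, Nonempty ({s // u s = a} ≃ {s // v s = a}) := fun a => by
    have := hu a
    have := hv a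
    exact nonempty_equiv_of_countable
  let E := fun a => (h a).some
  refine ⟨(Equiv.sigmaFiberEquiv u).symm.trans
    ((Equiv.sigmaCongrRight E).trans (Equiv.sigmaFiberEquiv v)), fun s => ?_⟩
  exact (E (u s) ⟨s, rfl⟩).2

theorem exists_sheetPerm (k : Fin 3) (n : ℕ+) :
    ∃ e : Equiv.Perm Sheet, ∀ s, sheetLabel (e s) (attachIndex k n) = pantsLabel k s :=
  exists_perm_of_infinite_fibers (pantsLabel k) (fun s => sheetLabel s (attachIndex k n))
    (infinite_pantsLabel_fiber k) (infinite_sheetLabel_fiber (attachIndex k n))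

/-- The permutation of the sheets that describes how the lifts of the `n`-th pair of pants are
attached along the `k`-th boundary circle. -/
def sheetPerm (k : Fin 3) (n : ℕ+) : Equiv.Perm Sheet := (exists_sheetPerm k n).choose

theorem sheetLabel_sheetPerm (k : Fin 3) (n : ℕ+) (s : Sheet) :
    sheetLabel (sheetPerm k n s) (attachIndex k n) = pantsLabel k s :=
  (exists_sheetPerm k n).choose_spec s

end

noncomputable section

/-! ## The boundary circles of the pair of pants -/

/-- The centres of the three boundary circles of the pair of pants. -/
def ctr : Fin 3 → ℂ := ![0, Complex.I / 2, -(Complex.I / 2)]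

/-- The radii of the three boundary circles of the pair of pants. -/
def rad : Fin 3 → ℝ := ![1, 1 / 4, 1 / 4]

/-- The side of the three boundary circles on which the pair of pants lies. -/
def sgn : Fin 3 → ℝ := ![1, -1, -1]

/-- The signed distance to the `k`-th boundary circle, nonnegative on the pair of pants. -/
def gap (k : Fin 3) (z : ℂ) : ℝ := sgn k * (rad k - ‖z - ctr k‖)

theorem gap_zero (z : ℂ) : gap 0 z = 1 - ‖z‖ := by simp [gap, sgn, rad, ctr]

theorem gap_one (z : ℂ) : gap 1 z = ‖z - Complex.I / 2‖ - 1 / 4 := by simp [gap, sgn, rad, ctr]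

theorem gap_two (z : ℂ) : gap 2 z = ‖z + Complex.I / 2‖ - 1 / 4 := by
  simp [gap, sgn, rad, ctr]

theorem continuous_gap (k : Fin 3) : Continuous (gap k) := by
  unfold gap
  fun_prop

theorem mem_pants_iff_gap {z : ℂ} : z ∈ pants ↔ ∀ k, 0 ≤ gap k z := by
  rw [mem_pants, Fin.forall_fin_succ, Fin.forall_fin_two]
  simp only [Fin.succ_zero_eq_one, Fin.succ_one_eq_two, gap_zero, gap_one, gap_two,
    dist_eq_norm, sub_zero, sub_neg_eq_add, sub_nonneg]

theorem norm_I_half : ‖Complex.I / 2‖ = 1 / 2 := by simp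

theorem norm_ge_sub_half (z : ℂ) : ‖z‖ - 1 / 2 ≤ ‖z - Complex.I / 2‖ := by
  have := norm_sub_norm_le z (Complex.I / 2)
  rwa [norm_I_half] at this

theorem norm_ge_add_half (z : ℂ) : ‖z‖ - 1 / 2 ≤ ‖z + Complex.I / 2‖ := by
  have := norm_sub_norm_le z (-(Complex.I / 2))
  rwa [norm_neg, norm_I_half, sub_neg_eq_add] at this

theorem norm_le_sub_half (z : ℂ) : ‖z‖ ≤ ‖z - Complex.I / 2‖ + 1 / 2 := by
  linarith [norm_ge_sub_half z]

theorem norm_le_add_half (z : ℂ) : ‖z‖ ≤ ‖z + Complex.I / 2‖ + 1 / 2 := by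
  linarith [norm_ge_add_half z]

theorem one_le_norm_add_norm (z : ℂ) : 1 ≤ ‖z - Complex.I / 2‖ + ‖z + Complex.I / 2‖ := by
  have := norm_sub_le (z + Complex.I / 2) (z - Complex.I / 2)
  rw [show z + Complex.I / 2 - (z - Complex.I / 2) = Complex.I by ring, Complex.norm_I] at this
  linarith

/-- The three boundary circles are at least 1/4 apart, so their collars of width 1/8 are disjoint.
-/
theorem gap_ge_of_ne {j k : Fin 3} (hjk : j ≠ k) {z : ℂ} (h : gap k z < 1 / 8) :
    1 / 8 ≤ gap j z := by
  have h₁ := norm_ge_sub_half z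
  have h₂ := norm_ge_add_half z
  have h₃ := one_le_norm_add_norm z
  fin_cases j <;> fin_cases k <;>
    simp only [Fin.zero_eta, Fin.mk_one, Fin.reduceFinMk, ne_eq, not_true_eq_false, gap_zero, gap_one, gap_two] at * <;>
    linarith

/-- The boundary circle next to which a point near the boundary lies. -/
def region (z : ℂ) : Fin 3 := if 15 / 16 < ‖z‖ then 0 else if 0 < z.im then 1 else 2

theorem region_eq {k : Fin 3} {z : ℂ} (h : gap k z < 1 / 16) : region z = k := by
  have h₁ := norm_le_sub_half z
  have h₂ := norm_le_add_half z
  have h₃ := Complex.abs_im_le_norm (z - Complex.I / 2)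
  have h₄ := Complex.abs_im_le_norm (z + Complex.I / 2)
  simp only [Complex.sub_im, Complex.add_im, Complex.div_ofNat_im, Complex.I_im, abs_le] at h₃ h₄
  unfold region
  fin_cases k
  · simp only [Fin.zero_eta, gap_zero] at h
    rw [if_pos (by linarith)]
    rfl
  · simp only [Fin.mk_one, gap_one] at h
    rw [if_neg (by linarith), if_pos (by linarith)]
    rfl
  · simp only [Fin.reduceFinMk, gap_two] at h
    rw [if_neg (by linarith), if_neg (by linarith)]
    rfl

theorem sub_ctr_ne_zero {k : Fin 3} {z : ℂ} (hz : z ∈ pants) (h : gap k z < 1 / 8) :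
    z - ctr k ≠ 0 := by
  intro h₀
  have hk := mem_pants_iff_gap.1 hz k
  rw [gap, h₀, norm_zero] at h hk
  fin_cases k
  · norm_num [sgn, rad] at h
  · norm_num [sgn, rad] at hk
  · norm_num [sgn, rad] at hk

/-- The distance to the boundary of the pair of pants. -/
def depth (z : ℂ) : ℝ := min (gap 0 z) (min (gap 1 z) (gap 2 z))

theorem continuous_depth : Continuous depth :=
  (continuous_gap 0).min ((continuous_gap 1).min (continuous_gap 2))

theorem lt_depth_iff {a : ℝ} {z : ℂ} : a < depth z ↔ ∀ k, a < gap k z := by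
  rw [depth, lt_min_iff, lt_min_iff, Fin.forall_fin_succ, Fin.forall_fin_two]
  rfl

theorem depth_lt_iff {a : ℝ} {z : ℂ} : depth z < a ↔ ∃ k, gap k z < a := by
  rw [depth, min_lt_iff, min_lt_iff, Fin.exists_fin_succ, Fin.exists_fin_two]
  rfl

theorem depth_nonneg {z : ℂ} (hz : z ∈ pants) : 0 ≤ depth z :=
  le_min (mem_pants_iff_gap.1 hz 0) (le_min (mem_pants_iff_gap.1 hz 1) (mem_pants_iff_gap.1 hz 2))

theorem mem_pants_of_depth {z : ℂ} (hz : 0 < depth z) : z ∈ pants :=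
  mem_pants_iff_gap.2 fun k => (lt_depth_iff.1 hz k).le

theorem depth_eq_zero {z : ℂ} (hz : z ∈ pants) {k : Fin 3} (h : gap k z = 0) : depth z = 0 := by
  refine le_antisymm ?_ (depth_nonneg hz)
  by_contra hlt
  have := lt_depth_iff.1 (not_le.1 hlt) k
  linarith

/-! ## Maps out of the Hawaiian Pants -/

/-- The map from the earring to the Hawaiian Pants. -/
def mkE (z : earring) : Space := Quot.mk Glue (Sum.inl z)

/-- The map from the `n`-th pair of pants to the Hawaiian Pants. -/
def mkP (n : ℕ+) (z : pants) : Space := Quot.mk Glue (Sum.inr ⟨n, z⟩)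

theorem continuous_mkE : Continuous mkE := continuous_quot_mk.comp continuous_inl

theorem continuous_mkP (n : ℕ+) : Continuous (mkP n) :=
  continuous_quot_mk.comp (continuous_inr.comp continuous_sigmaMk)

theorem space_cases (x : Space) : (∃ z, x = mkE z) ∨ ∃ n z, x = mkP n z := by
  induction x using Quot.ind with
  | _ p =>
    rcases p with z | ⟨n, z⟩
    · exact Or.inl ⟨z, rfl⟩
    · exact Or.inr ⟨n, z, rfl⟩

theorem gap_of_circleLoop {k : Fin 3} {z : ℂ} {t : I} (h : z = circleLoop (ctr k) (rad k) t) :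
    gap k z = 0 := by
  have hr : 0 ≤ rad k := by fin_cases k <;> norm_num [rad]
  rw [gap, h, ← dist_eq_norm, dist_circleLoop _ hr, sub_self, mul_zero]

theorem mkP_of_gap_eq_zero (n : ℕ+) {k : Fin 3} (z : pants) (h : gap k z = 0) :
    mkP n z = mkE (radial (attachIndex k n) (z - ctr k)) := by
  have hr : 0 < rad k := by fin_cases k <;> norm_num [rad]
  have hs : sgn k ≠ 0 := by fin_cases k <;> norm_num [sgn]
  have hd : dist (z : ℂ) (ctr k) = rad k := by
    rw [dist_eq_norm]
    have := (mul_eq_zero.1 h).resolve_left hs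
    linarith
  obtain ⟨t, ht⟩ := exists_circleLoop_eq (ctr k) hr hd
  rw [← ht, radial_circleLoop _ _ hr]
  fin_cases k
  · have : z = alpha t := Subtype.ext ht.symm
    rw [this]
    exact Quot.sound (Glue.outer n t)
  · have : z = beta t := Subtype.ext ht.symm
    rw [this]
    exact Quot.sound (Glue.inner₁ n t)
  · have : z = gamma t := Subtype.ext ht.symm
    rw [this]
    exact Quot.sound (Glue.inner₂ n t)

/-- The map out of the Hawaiian Pants given by maps on the earring and on the pairs of pants. -/
def Space.desc {Y : Type*} (F : earring → Y) (G : ℕ+ → pants → Y)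
    (h : ∀ n k (z : pants), gap k z = 0 → G n z = F (radial (attachIndex k n) (z - ctr k))) :
    Space → Y :=
  Quot.lift (Sum.elim F fun p => G p.1 p.2) (by
    have key : ∀ n k t (z : pants), (z : ℂ) = circleLoop (ctr k) (rad k) t →
        G n z = F (ell (attachIndex k n) t) := by
      intro n k t z hz
      have hr : 0 < rad k := by fin_cases k <;> norm_num [rad]
      rw [h n k z (gap_of_circleLoop hz), hz, radial_circleLoop _ _ hr]
    rintro _ _ (⟨n, t⟩ | ⟨n, t⟩ | ⟨n, t⟩)
    · exact key n 0 t (alpha t) rfl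
    · exact key n 1 t (beta t) rfl
    · exact key n 2 t (gamma t) rfl)

/-- An open subset of a quotient carries the quotient topology from its preimage, so continuity is
checked on the earring and on each pair of pants. -/
theorem continuousOn_space {Y : Type*} [TopologicalSpace Y] {φ : Space → Y} {O : Set Space}
    (hO : IsOpen O) (hE : ∀ z, mkE z ∈ O → ContinuousAt (fun w => φ (mkE w)) z)
    (hP : ∀ n z, mkP n z ∈ O → ContinuousAt (fun w => φ (mkP n w)) z) : ContinuousOn φ O := by
  have hq : Topology.IsQuotientMap (Quot.mk Glue) := isQuotientMap_quot_mk
  refine (hq.continuousOn_isOpen_iff hO).2 ?_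
  refine continuousOn_of_forall_continuousAt ?_
  rintro (z | ⟨n, z⟩) hz
  · exact Topology.IsOpenEmbedding.inl.continuousAt_iff.1 (hE z hz)
  · exact (Topology.IsOpenEmbedding.inr.comp
      Topology.IsOpenEmbedding.sigmaMk).continuousAt_iff.1 (hP n z hz)

theorem continuous_space {Y : Type*} [TopologicalSpace Y] {φ : Space → Y}
    (hE : Continuous fun w => φ (mkE w)) (hP : ∀ n, Continuous fun w => φ (mkP n w)) :
    Continuous φ :=
  continuousOn_univ.1 (continuousOn_space isOpen_univ (fun _ _ => hE.continuousAt)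
    fun n _ _ => (hP n).continuousAt)

/-- The distance to the earring in the Hawaiian Pants. -/
def spaceDepth : Space → ℝ :=
  Space.desc (fun _ => 0) (fun _ z => depth z) fun _ _ z h => depth_eq_zero z.2 h

theorem spaceDepth_mkE (z : earring) : spaceDepth (mkE z) = 0 := rfl

theorem continuous_spaceDepth : Continuous spaceDepth :=
  continuous_space continuous_const fun _ => continuous_depth.comp continuous_subtype_val

/-- The collar neighbourhood of the earring. -/
def collar : Set Space := {x | spaceDepth x < 1 / 16}

/-- The union of the interiors of the pairs of pants. -/
def pantsInterior : Set Space := {x | 0 < spaceDepth x}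

theorem isOpen_collar : IsOpen collar := isOpen_Iio.preimage continuous_spaceDepth

theorem isOpen_pantsInterior : IsOpen pantsInterior := isOpen_Ioi.preimage continuous_spaceDepth

theorem mkE_mem_collar (z : earring) : mkE z ∈ collar := by
  change spaceDepth (mkE z) < 1 / 16
  rw [spaceDepth_mkE]
  norm_num

theorem mkE_notMem_pantsInterior (z : earring) : mkE z ∉ pantsInterior := lt_irrefl (0 : ℝ)

theorem exists_gap_of_mem_collar {n : ℕ+} {z : pants} (h : mkP n z ∈ collar) :
    ∃ k, gap k z < 1 / 16 := depth_lt_iff.1 h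

theorem eventually_gap_lt {k : Fin 3} {z : pants} {a : ℝ} (h : gap k z < a) :
    ∀ᶠ w : pants in 𝓝 z, gap k w < a :=
  ((continuous_gap k).comp continuous_subtype_val).continuousAt.eventually (gt_mem_nhds h)

theorem eventually_depth_pos {z : pants} (h : 0 < depth z) :
    ∀ᶠ w : pants in 𝓝 z, 0 < depth (w : ℂ) :=
  (continuous_depth.comp continuous_subtype_val).continuousAt.eventually (lt_mem_nhds h)

/-! ### The retraction of the collar -/

/-- The radial retraction of the collar onto the earring. -/
def collarRetr : Space → earring :=
  Space.desc id (fun n z => radial (attachIndex (region z) n) (z - ctr (region z)))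
    fun n k z h => by rw [region_eq (by rw [h]; norm_num)]; rfl

theorem collarRetr_mkP (n : ℕ+) {z : pants} {k : Fin 3} (h : gap k z < 1 / 16) :
    collarRetr (mkP n z) = radial (attachIndex k n) (z - ctr k) := by
  change radial (attachIndex (region z) n) (z - ctr (region z)) = _
  rw [region_eq h]

theorem continuousOn_collarRetr : ContinuousOn collarRetr collar := by
  refine continuousOn_space isOpen_collar (fun z _ => continuousAt_id) fun n z hz => ?_
  obtain ⟨k, hk⟩ := exists_gap_of_mem_collar hz
  have h₁ : ContinuousAt (fun w : pants => radial (attachIndex k n) ((w : ℂ) - ctr k)) z := by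
    have h₂ : ContinuousAt (fun w : pants => (w : ℂ) - ctr k) z := by fun_prop
    exact ContinuousAt.comp (f := fun w : pants => (w : ℂ) - ctr k)
      (continuousAt_radial _ (sub_ctr_ne_zero z.2 (hk.trans (by norm_num)))) h₂
  refine h₁.congr ?_
  filter_upwards [eventually_gap_lt hk] with w hw
  exact (collarRetr_mkP n hw).symm

/-! ### The deformation of the collar -/

/-- The distance by which a point at distance `g` to the boundary is pushed. -/
def pushAmount (g : ℝ) : ℝ := max 0 (min g (1 / 8 - g))

theorem pushAmount_eq_zero {g : ℝ} (h : 1 / 8 ≤ g) : pushAmount g = 0 :=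
  max_eq_left (min_le_of_right_le (by linarith))

theorem pushAmount_zero : pushAmount 0 = 0 := by norm_num [pushAmount]

/-- Within 1/16 of the boundary the push covers the whole distance, so time 1 lands on the boundary;
it tapers off to zero at 1/8. -/
theorem pushAmount_eq {g : ℝ} (h₀ : 0 ≤ g) (h : g < 1 / 16) : pushAmount g = g := by
  rw [pushAmount, min_eq_left (by linarith), max_eq_right h₀]

theorem pushAmount_nonneg (g : ℝ) : 0 ≤ pushAmount g := le_max_left _ _

theorem pushAmount_le {g : ℝ} (h₀ : 0 ≤ g) : pushAmount g ≤ g := max_le h₀ (min_le_left _ _)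

/-- The displacement towards the `k`-th boundary circle. -/
def pushStep (k : Fin 3) (t : ℝ) (z : ℂ) : ℂ :=
  ((t * sgn k * pushAmount (gap k z) / ‖z - ctr k‖ : ℝ) : ℂ) * (z - ctr k)

/-- The map that pushes the points of a collar towards the boundary. -/
def push (t : ℝ) (z : ℂ) : ℂ := z + (pushStep 0 t z + pushStep 1 t z + pushStep 2 t z)

theorem pushStep_eq_zero {k : Fin 3} {t : ℝ} {z : ℂ} (h : pushAmount (gap k z) = 0) :
    pushStep k t z = 0 := by simp [pushStep, h]

theorem push_eq_of_gap_lt {k : Fin 3} (t : ℝ) {z : ℂ} (h : gap k z < 1 / 8) :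
    push t z = z + pushStep k t z := by
  have hj : ∀ j, j ≠ k → pushStep j t z = 0 := fun j hj =>
    pushStep_eq_zero (pushAmount_eq_zero (gap_ge_of_ne hj h))
  unfold push
  fin_cases k
  · rw [hj 1 (by decide), hj 2 (by decide)]
    simp
  · rw [hj 0 (by decide), hj 2 (by decide)]
    simp
  · rw [hj 0 (by decide), hj 1 (by decide)]
    simp

theorem push_eq_self {z : ℂ} (h : ∀ k, 1 / 8 ≤ gap k z) (t : ℝ) : push t z = z := by
  have hj : ∀ j, pushStep j t z = 0 := fun j => pushStep_eq_zero (pushAmount_eq_zero (h j))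
  simp [push, hj]

/-- The point moves along its ray from the centre of the k-th circle, so its radial image in the
earring does not change. -/
theorem push_sub_ctr {k : Fin 3} {t : ℝ} {z : ℂ} (hz : z ∈ pants) (h : gap k z < 1 / 8)
    (ht : t ∈ Set.Icc (0 : ℝ) 1) :
    ∃ c : ℝ, 0 < c ∧ push t z - ctr k = c * (z - ctr k) ∧
      gap k (push t z) = gap k z - t * pushAmount (gap k z) := by
  have hρ : 0 < ‖z - ctr k‖ := norm_pos_iff.2 (sub_ctr_ne_zero hz h)
  have hg := mem_pants_iff_gap.1 hz k
  have hp₀ := pushAmount_nonneg (gap k z)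
  have hp₁ := pushAmount_le hg
  have htp : t * pushAmount (gap k z) ≤ gap k z := by nlinarith [ht.1, ht.2]
  have htp₀ : 0 ≤ t * pushAmount (gap k z) := mul_nonneg ht.1 hp₀
  have hs : sgn k * sgn k = 1 := by fin_cases k <;> norm_num [sgn]
  have hc : 0 < ‖z - ctr k‖ + t * sgn k * pushAmount (gap k z) := by
    have hgk : gap k z = sgn k * (rad k - ‖z - ctr k‖) := rfl
    fin_cases k
    · simp only [Fin.zero_eta, sgn, rad, Matrix.cons_val_zero] at *
      linarith
    · simp only [Fin.mk_one, sgn, rad, Matrix.cons_val_one, Matrix.cons_val_zero] at *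
      linarith
    · simp only [Fin.reduceFinMk, sgn, rad, Matrix.cons_val] at *
      linarith
  have hpush : push t z - ctr k =
      ((1 + t * sgn k * pushAmount (gap k z) / ‖z - ctr k‖ : ℝ) : ℂ) * (z - ctr k) := by
    rw [push_eq_of_gap_lt t h, pushStep]
    push_cast
    ring
  have hc' : 0 < 1 + t * sgn k * pushAmount (gap k z) / ‖z - ctr k‖ := by
    have := div_pos hc hρ
    rwa [add_div, div_self hρ.ne'] at this
  refine ⟨_, hc', hpush, ?_⟩
  have hnorm : ‖push t z - ctr k‖ = ‖z - ctr k‖ + t * sgn k * pushAmount (gap k z) := by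
    rw [hpush, norm_mul, Complex.norm_real, Real.norm_of_nonneg hc'.le]
    field_simp
  rw [gap, hnorm]
  have hgk : gap k z = sgn k * (rad k - ‖z - ctr k‖) := rfl
  linear_combination -hgk - t * pushAmount (gap k z) * hs

theorem push_mem {t : ℝ} {z : ℂ} (hz : z ∈ pants) (ht : t ∈ Set.Icc (0 : ℝ) 1) :
    push t z ∈ pants := by
  by_cases h : ∀ k, 1 / 8 ≤ gap k z
  · rwa [push_eq_self h]
  · push Not at h
    obtain ⟨k, hk⟩ := h
    obtain ⟨c, -, -, hgap⟩ := push_sub_ctr hz hk ht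
    have hg := mem_pants_iff_gap.1 hz k
    have hp₀ := pushAmount_nonneg (gap k z)
    have hp₁ := pushAmount_le hg
    have htp : t * pushAmount (gap k z) ≤ gap k z := by nlinarith [ht.1, ht.2]
    have htp₀ : 0 ≤ t * pushAmount (gap k z) := mul_nonneg ht.1 hp₀
    refine mem_pants_iff_gap.2 fun j => ?_
    rcases eq_or_ne j k with rfl | hj
    · linarith
    · have := gap_ge_of_ne hj (z := push t z) (k := k) (by linarith)
      linarith

theorem push_eq_self_of_gap_eq_zero {k : Fin 3} {z : ℂ} (h : gap k z = 0) (t : ℝ) :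
    push t z = z := by
  rw [push_eq_of_gap_lt (k := k) t (by rw [h]; norm_num), pushStep_eq_zero, add_zero]
  rw [h, pushAmount_zero]

theorem push_zero (z : ℂ) : push 0 z = z := by simp [push, pushStep]

theorem continuousOn_push :
    ContinuousOn (fun p : ℂ × ℝ => push p.2 p.1) (pants ×ˢ Set.univ) := by
  have hk : ∀ k, ContinuousOn (fun p : ℂ × ℝ => pushStep k p.2 p.1) (pants ×ˢ Set.univ) := by
    intro k
    rintro ⟨z, t⟩ ⟨hz, -⟩
    refine ContinuousAt.continuousWithinAt ?_
    have hc : ContinuousAt (fun p : ℂ × ℝ => gap k p.1) (z, t) :=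
      ((continuous_gap k).comp continuous_fst).continuousAt
    by_cases h : z - ctr k = 0
    -- The singularity is harmless: the inner centres are not in the pants, and near the outer
    -- centre the push vanishes.
    · have hgap : 1 / 8 < gap k z := by
        have hk := mem_pants_iff_gap.1 hz k
        rw [gap, h, norm_zero] at hk ⊢
        fin_cases k
        · norm_num [sgn, rad]
        · norm_num [sgn, rad] at hk
        · norm_num [sgn, rad] at hk
      refine (continuousAt_const : ContinuousAt (fun _ => (0 : ℂ)) (z, t)).congr ?_
      filter_upwards [hc.eventually (lt_mem_nhds hgap)] with p hp
      exact (pushStep_eq_zero (pushAmount_eq_zero hp.le)).symm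
    · have hc' : ContinuousAt (fun p : ℂ × ℝ => pushAmount (gap k p.1)) (z, t) := by
        have : Continuous pushAmount := by
          unfold pushAmount
          fun_prop
        exact this.continuousAt.comp hc
      refine ContinuousAt.mul (Complex.continuous_ofReal.continuousAt.comp ?_) (by fun_prop)
      exact (ContinuousAt.mul (by fun_prop) hc').div (by fun_prop) (norm_ne_zero_iff.2 h)
  exact continuousOn_fst.add (((hk 0).add (hk 1)).add (hk 2))

end

noncomputable section

/-- The deformation of the `n`-th pair of pants. -/
def pushPants (n : ℕ+) : C(pants × I, Space) where
  toFun p := mkP n ⟨push p.2 p.1, push_mem p.1.2 p.2.2⟩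
  continuous_toFun := by
    refine (continuous_mkP n).comp (Continuous.subtype_mk ?_ _)
    exact continuousOn_push.comp_continuous
      (f := fun p : pants × I => ((p.1 : ℂ), (p.2 : ℝ))) (by fun_prop) fun p => ⟨p.1.2, trivial⟩

/-- The deformation of the Hawaiian Pants that pushes a collar into the earring. -/
def deform : Space → C(I, Space) :=
  Space.desc (fun z => .const I (mkE z)) (fun n z => (pushPants n).curry z) (by
    intro n k z h
    ext t
    rw [ContinuousMap.const_apply, ← mkP_of_gap_eq_zero n z h]
    exact congrArg (mkP n) (Subtype.ext (push_eq_self_of_gap_eq_zero h t)))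

/-- With values in the function space C(I, Space), continuity is checked piecewise on the quotient,
and no product of the quotient map with I is needed. -/
theorem continuous_deform : Continuous deform :=
  continuous_space (ContinuousMap.continuous_const'.comp continuous_mkE)
    fun n => (pushPants n).curry.continuous

theorem deform_zero (x : Space) : deform x 0 = x := by
  rcases space_cases x with ⟨z, rfl⟩ | ⟨n, z, rfl⟩
  · rfl
  · exact congrArg (mkP n) (Subtype.ext (push_zero z))

theorem deform_one {x : Space} (hx : x ∈ collar) : deform x 1 = mkE (collarRetr x) := by
  rcases space_cases x with ⟨z, rfl⟩ | ⟨n, z, rfl⟩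
  · rfl
  · obtain ⟨k, hk⟩ := exists_gap_of_mem_collar hx
    have hg := mem_pants_iff_gap.1 z.2 k
    obtain ⟨c, hc, hpush, hgap⟩ := push_sub_ctr (t := 1) z.2 (hk.trans (by norm_num)) (by simp)
    rw [pushAmount_eq hg hk, one_mul, sub_self] at hgap
    rw [collarRetr_mkP n hk, ← radial_mul _ hc, ← hpush]
    exact mkP_of_gap_eq_zero n ⟨push 1 z, push_mem z.2 (by simp)⟩ hgap

/-- The homotopy between the retraction of the collar and its inclusion. -/
def collarHomotopy :
    ((⟨mkE, continuous_mkE⟩ : C(earring, Space)).comp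
      (⟨collar.domRestrict collarRetr, continuousOn_collarRetr.domRestrict⟩ : C(collar, earring))).Homotopy
      (⟨Subtype.val, continuous_subtype_val⟩ : C(collar, Space)) :=
  ContinuousMap.Homotopy.symm
    { toFun := fun p => deform p.2 p.1
      continuous_toFun := by
        have h := ContinuousMap.continuous_uncurry_of_continuous
          ⟨fun x : collar => deform x, continuous_deform.comp continuous_subtype_val⟩
        exact h.comp continuous_swap
      map_zero_left := fun x => deform_zero x
      map_one_left := fun x => deform_one x.2 }

/-! ### The interiors of the pairs of pants -/

open Classical in
/-- The coordinate on the interior of the `n`-th pair of pants, with value `5` elsewhere. -/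
def pantsCoord (n : ℕ+) : Space → ℂ :=
  Space.desc (fun _ => 5) (fun m z => if m = n ∧ 0 < depth z then z else 5) (by
    intro m k z h
    rw [if_neg]
    rintro ⟨-, h'⟩
    rw [depth_eq_zero z.2 h] at h'
    exact lt_irrefl _ h')

open Classical in
theorem pantsCoord_mkP (n m : ℕ+) (z : pants) :
    pantsCoord n (mkP m z) = if m = n ∧ 0 < depth z then (z : ℂ) else 5 := rfl

theorem continuousOn_pantsCoord (n : ℕ+) : ContinuousOn (pantsCoord n) pantsInterior := by
  refine continuousOn_space isOpen_pantsInterior (fun z _ => continuousAt_const) fun m z hz => ?_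
  simp only [pantsCoord_mkP]
  by_cases h : m = n
  · refine continuousAt_subtype_val.congr ?_
    filter_upwards [eventually_depth_pos hz] with w hw
    rw [if_pos ⟨h, hw⟩]
  · simp only [h, false_and, if_false]
    exact continuousAt_const

/-- Interior points of the pairs of pants have simply connected neighbourhoods. -/
theorem exists_nhds_joins (n : ℕ+) (z : pants) (hz : 0 < depth z) :
    ∃ U : Set Space, IsOpen U ∧ mkP n z ∈ U ∧ ∀ (a b : UnivCover) (Γ : Path a b),
      (∀ t, (Γ t).endpoint ∈ U) →
        PathClass.Joins a b (Γ.map PathClass.continuous_endpoint) := by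
  obtain ⟨ε, hε, hball⟩ := Metric.mem_nhds_iff.1
    ((isOpen_Ioi.preimage continuous_depth).mem_nhds (show (z : ℂ) ∈ depth ⁻¹' Set.Ioi 0 from hz))
  -- The default value 5 of `pantsCoord` is outside the pants, so the preimage of the ball is
  -- confined to the n-th interior.
  have hball5 : (5 : ℂ) ∉ Metric.ball (z : ℂ) ε := by
    intro h
    have := (mem_pants_iff_gap.1 (mem_pants_of_depth (hball h))) 0
    rw [gap_zero] at this
    norm_num at this
  let U : Set Space := pantsInterior ∩ pantsCoord n ⁻¹' Metric.ball (z : ℂ) ε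
  have hU : IsOpen U :=
    (continuousOn_pantsCoord n).isOpen_inter_preimage isOpen_pantsInterior Metric.isOpen_ball
  have : ContractibleSpace (Metric.ball (z : ℂ) ε) :=
    (convex_ball (z : ℂ) ε).contractibleSpace ⟨z, Metric.mem_ball_self hε⟩
  let r : C(U, Metric.ball (z : ℂ) ε) :=
    ⟨fun x => ⟨pantsCoord n x, x.2.2⟩, Continuous.subtype_mk
      (((continuousOn_pantsCoord n).mono Set.inter_subset_left).domRestrict) _⟩
  let i : C(Metric.ball (z : ℂ) ε, Space) :=
    ⟨fun w => mkP n ⟨w, mem_pants_of_depth (hball w.2)⟩, (continuous_mkP n).comp (by fun_prop)⟩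
  have hir : i.comp r = ⟨Subtype.val, continuous_subtype_val⟩ := by
    ext ⟨x, hx, hx'⟩
    change mkP n ⟨pantsCoord n x, _⟩ = x
    rcases space_cases x with ⟨y, rfl⟩ | ⟨m, y, rfl⟩
    · exact (mkE_notMem_pantsInterior y hx).elim
    · by_cases h : m = n ∧ 0 < depth (y : ℂ)
      · have e : pantsCoord n (mkP m y) = y := by rw [pantsCoord_mkP, if_pos h]
        obtain ⟨rfl, -⟩ := h
        exact congrArg (mkP m) (Subtype.ext e)
      · rw [Set.mem_preimage, pantsCoord_mkP, if_neg h] at hx'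
        exact (hball5 hx').elim
  refine ⟨U, hU, ⟨hz, ?_⟩, fun a b Γ hΓ => ?_⟩
  · rw [Set.mem_preimage, pantsCoord_mkP, if_pos ⟨rfl, hz⟩]
    exact Metric.mem_ball_self hε
  · exact PathClass.joins_of_deformation hU r i
      ((ContinuousMap.Homotopy.refl (i.comp r)).cast rfl hir)
      (fun _ => PathClass.HasUniquePathLifting.of_simplyConnected)
      (fun _ _ _ => SimplyConnectedSpace.paths_homotopic _ _) Γ hΓ

/-- Points of depth below 1/16 lie in the collar, which deforms to the earring; all others have disc
neighbourhoods. -/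
theorem hasUniquePathLifting_space
    (h : ∀ {z z' : earring} (γ δ : Path z z'),
      (γ.map continuous_mkE).Homotopic (δ.map continuous_mkE) → γ.Homotopic δ) :
    PathClass.HasUniquePathLifting Space b₀ := by
  refine PathClass.HasUniquePathLifting.of_local fun x => ?_
  rcases lt_or_ge (spaceDepth x) (1 / 16) with hx | hx
  · exact ⟨collar, isOpen_collar, hx, fun a b Γ hΓ =>
      PathClass.joins_of_deformation isOpen_collar _ _ collarHomotopy
        (isLocallyRetractable_earring.hasUniquePathLifting) h Γ hΓ⟩
  · rcases space_cases x with ⟨z, rfl⟩ | ⟨n, z, rfl⟩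
    · rw [spaceDepth_mkE] at hx
      norm_num at hx
    · exact exists_nhds_joins n z (lt_of_lt_of_le (by norm_num) hx)

/-! ### Path connectedness -/

theorem continuous_circleLoop (c : ℂ) (r : ℝ) : Continuous (circleLoop c r) := by
  unfold circleLoop
  fun_prop

theorem joined_origin (z : earring) : Joined origin z := by
  obtain ⟨m, hm⟩ := Set.mem_iUnion.1 z.2
  have hpos : (0 : ℝ) < 1 / m := by positivity
  obtain ⟨t, ht⟩ := exists_circleLoop_eq _ hpos hm
  have hc : Continuous (ell m) := (continuous_circleLoop _ _).subtype_mk _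
  have h₀ : ell m 0 = origin := Subtype.ext (by simp [ell, circleLoop, origin])
  have h₁ : ell m t = z := Subtype.ext ht
  have := (PathConnectedSpace.joined (0 : I) t).map hc
  rwa [h₀, h₁] at this

theorem mem_pants_iff_sq {z : ℂ} : z ∈ pants ↔ z.re ^ 2 + z.im ^ 2 ≤ 1 ∧
    1 / 16 ≤ z.re ^ 2 + (z.im - 1 / 2) ^ 2 ∧ 1 / 16 ≤ z.re ^ 2 + (z.im + 1 / 2) ^ 2 := by
  have h₀ : ‖z‖ ^ 2 = z.re ^ 2 + z.im ^ 2 := by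
    rw [Complex.sq_norm, Complex.normSq_apply]
    ring
  have h₁ : dist z (Complex.I / 2) ^ 2 = z.re ^ 2 + (z.im - 1 / 2) ^ 2 := by
    rw [dist_eq_norm, Complex.sq_norm, Complex.normSq_apply]
    simp
    ring
  have h₂ : dist z (-(Complex.I / 2)) ^ 2 = z.re ^ 2 + (z.im + 1 / 2) ^ 2 := by
    rw [dist_eq_norm, Complex.sq_norm, Complex.normSq_apply]
    simp
    ring
  rw [mem_pants, dist_zero_right, ← h₀, ← h₁, ← h₂, sq_le_one_iff₀ (norm_nonneg z),
    show (1 / 16 : ℝ) = (1 / 4) ^ 2 by norm_num, sq_le_sq₀ (by norm_num) dist_nonneg,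
    sq_le_sq₀ (by norm_num) dist_nonneg]

/-- Moving horizontally away from the imaginary axis increases the distance to both inner centres,
so the path stays in the pants until it meets the outer circle. -/
theorem exists_joined_boundary (z : pants) : ∃ w : pants, gap 0 w = 0 ∧ Joined z w := by
  obtain ⟨hz, hz₁, hz₂⟩ := mem_pants_iff_sq.1 z.2
  obtain ⟨s, hs, hs₀, hs₁⟩ : ∃ s : ℝ, s ^ 2 = 1 - (z : ℂ).im ^ 2 ∧ 0 ≤ (s - (z : ℂ).re) * (z : ℂ).re ∧
      0 ≤ (s - (z : ℂ).re) * s := by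
    have hq : Real.sqrt (1 - (z : ℂ).im ^ 2) ^ 2 = 1 - (z : ℂ).im ^ 2 :=
      Real.sq_sqrt (by nlinarith [sq_nonneg (z : ℂ).re])
    have hq₀ := Real.sqrt_nonneg (1 - (z : ℂ).im ^ 2)
    set q := Real.sqrt (1 - (z : ℂ).im ^ 2)
    rcases le_total 0 (z : ℂ).re with h | h
    · have : (z : ℂ).re ≤ q := by nlinarith
      exact ⟨q, hq, by nlinarith, by nlinarith⟩
    · have : -(z : ℂ).re ≤ q := by nlinarith
      exact ⟨-q, by nlinarith, by nlinarith, by nlinarith⟩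
  set d : ℝ := s - (z : ℂ).re with hd
  have hmem : ∀ t : I, (z : ℂ) + ((t * d : ℝ) : ℂ) ∈ pants := by
    rintro ⟨t, ht₀, ht₁⟩
    have h₁ : (z : ℂ).re ^ 2 ≤ ((z : ℂ).re + t * d) ^ 2 := by
      nlinarith [mul_nonneg ht₀ hs₀, sq_nonneg (t * d)]
    have h₂ : ((z : ℂ).re + t * d) ^ 2 ≤ s ^ 2 := by
      have h₃ : 0 ≤ (1 - t) * (d * s + d * (z : ℂ).re + t * d ^ 2) :=
        mul_nonneg (by linarith) (by positivity)
      have h₄ : s = (z : ℂ).re + d := by rw [hd]; ring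
      have h₅ : s ^ 2 - ((z : ℂ).re + t * d) ^ 2 =
          (1 - t) * (d * s + d * (z : ℂ).re + t * d ^ 2) := by
        rw [h₄]
        ring
      linarith
    rw [mem_pants_iff_sq, Complex.add_re, Complex.add_im, Complex.ofReal_re, Complex.ofReal_im,
      add_zero]
    exact ⟨by linarith, by linarith, by linarith⟩
  refine ⟨⟨_, hmem 1⟩, ?_, ⟨⟨⟨fun t => ⟨_, hmem t⟩, by fun_prop⟩, ?_, rfl⟩⟩⟩
  · have h : ‖(z : ℂ) + (((1 : I) * d : ℝ) : ℂ)‖ ^ 2 = 1 := by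
      rw [Complex.sq_norm, Complex.normSq_apply]
      simp only [Set.Icc.coe_one, one_mul, Complex.add_re, Complex.add_im, Complex.ofReal_re,
        Complex.ofReal_im, add_zero, hd, add_sub_cancel]
      linarith
    rw [gap_zero, (pow_eq_one_iff_of_nonneg (norm_nonneg _) two_ne_zero).1 h, sub_self]
  · refine Subtype.ext ?_
    change (z : ℂ) + (((0 : I) * d : ℝ) : ℂ) = z
    simp

theorem joined_b₀ (x : Space) : Joined b₀ x := by
  have hE : ∀ z, Joined b₀ (mkE z) := fun z => (joined_origin z).map continuous_mkE
  rcases space_cases x with ⟨z, rfl⟩ | ⟨n, z, rfl⟩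
  · exact hE z
  · obtain ⟨w, hw, hzw⟩ := exists_joined_boundary z
    have := (hzw.map (continuous_mkP n)).symm
    rw [mkP_of_gap_eq_zero n w hw] at this
    exact (hE _).trans this

instance : PathConnectedSpace Space where
  nonempty := ⟨b₀⟩
  joined x y := (joined_b₀ x).symm.trans (joined_b₀ y)

end

noncomputable section

/-! ## Maps from the pair of pants to a circle -/

/-- The restriction of a real number to the unit interval. -/
def clamp (r : ℝ) : ℝ := max 0 (min 1 r)

theorem clamp_nonneg (r : ℝ) : 0 ≤ clamp r := le_max_left _ _

theorem clamp_le_one (r : ℝ) : clamp r ≤ 1 := max_le zero_le_one (min_le_left _ _)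

theorem clamp_of_one_le {r : ℝ} (h : 1 ≤ r) : clamp r = 1 := by
  rw [clamp, min_eq_left h, max_eq_right zero_le_one]

theorem clamp_of_nonpos {r : ℝ} (h : r ≤ 0) : clamp r = 0 :=
  max_eq_left ((min_le_right _ _).trans h)

/-- A map without zeros on the pair of pants which has winding number one along the outer and the
first inner boundary circle and which is constant on the second inner boundary circle. -/
def spread (z : ℂ) : ℂ :=
  (1 - (clamp (16 * (3 / 8 - ‖z + Complex.I / 2‖)) : ℂ)) *
    (z - (clamp (8 * (15 / 16 - ‖z‖)) : ℂ) * (Complex.I / 2)) -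
    (clamp (16 * (3 / 8 - ‖z + Complex.I / 2‖)) : ℂ)

theorem continuous_spread : Continuous spread := by
  unfold spread clamp
  fun_prop

/-- The value interpolates from z - k·i/2 to -1 with weight v. Where v > 0, z lies below the real
axis, so z - k·i/2 does too and the segment to -1 misses 0. Where v = 0, a zero has |z| = k/2 ≤ 1/2,
which forces k = 1 and z = i/2, a removed point. -/
theorem spread_ne_zero {z : ℂ} (hz : z ∈ pants) : spread z ≠ 0 := by
  intro h
  have hg := mem_pants_iff_gap.1 hz 1
  rw [gap_one] at hg
  set v := clamp (16 * (3 / 8 - ‖z + Complex.I / 2‖)) with hv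
  set k := clamp (8 * (15 / 16 - ‖z‖)) with hk
  have hk₀ := clamp_nonneg (8 * (15 / 16 - ‖z‖))
  have hk₁ := clamp_le_one (8 * (15 / 16 - ‖z‖))
  rw [← hk] at hk₀ hk₁
  have hspread : spread z = (1 - (v : ℂ)) * (z - (k : ℂ) * (Complex.I / 2)) - (v : ℂ) := rfl
  have hre := congrArg Complex.re (hspread.symm.trans h)
  have him := congrArg Complex.im (hspread.symm.trans h)
  simp at hre him
  rcases him with hv₁ | him
  · rw [← sub_eq_zero.1 hv₁] at hre
    norm_num at hre
  · have hi := Complex.abs_im_le_norm (z + Complex.I / 2)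
    simp only [Complex.add_im, Complex.div_ofNat_im, Complex.I_im, abs_le] at hi
    have hv₀ : v = 0 := clamp_of_nonpos (by linarith)
    have hzk : z = (k : ℂ) * (Complex.I / 2) := by
      rw [hspread, hv₀] at h
      simpa [sub_eq_zero] using h
    have hn : ‖z‖ = k / 2 := by
      rw [hzk, norm_mul, norm_I_half, Complex.norm_real, Real.norm_of_nonneg hk₀]
      ring
    have hk' : k = 1 := clamp_of_one_le (by linarith)
    rw [hzk, hk'] at hg
    norm_num at hg

theorem spread_of_gap_zero {z : ℂ} (h : gap 0 z < 1 / 16) : spread z = z := by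
  rw [gap_zero] at h
  have h₁ := norm_le_add_half z
  rw [spread, clamp_of_nonpos (by linarith), clamp_of_nonpos (by linarith)]
  simp

theorem spread_of_gap_one {z : ℂ} (h : gap 1 z < 1 / 16) : spread z = z - Complex.I / 2 := by
  rw [gap_one] at h
  have h₁ := norm_le_sub_half z
  have h₂ := one_le_norm_add_norm z
  rw [spread, clamp_of_nonpos (by linarith), clamp_of_one_le (by linarith)]
  simp

theorem spread_of_gap_two {z : ℂ} (h : gap 2 z < 1 / 16) : spread z = -1 := by
  rw [gap_two] at h
  rw [spread, clamp_of_one_le (by linarith)]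
  simp

open scoped ComplexConjugate

theorem conj_I_half : conj (Complex.I / 2) = -(Complex.I / 2) := by
  rw [map_div₀, Complex.conj_I, map_ofNat, neg_div]

theorem norm_conj_sub (z : ℂ) : ‖conj z - Complex.I / 2‖ = ‖z + Complex.I / 2‖ := by
  rw [← Complex.norm_conj, map_sub, Complex.conj_conj, conj_I_half, sub_neg_eq_add]

theorem norm_conj_add (z : ℂ) : ‖conj z + Complex.I / 2‖ = ‖z - Complex.I / 2‖ := by
  rw [← Complex.norm_conj, map_add, Complex.conj_conj, conj_I_half, ← sub_eq_add_neg]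

theorem gap_conj_zero (z : ℂ) : gap 0 (conj z) = gap 0 z := by
  rw [gap_zero, gap_zero, Complex.norm_conj]

theorem gap_conj_one (z : ℂ) : gap 1 (conj z) = gap 2 z := by
  rw [gap_one, gap_two, norm_conj_sub]

theorem gap_conj_two (z : ℂ) : gap 2 (conj z) = gap 1 z := by
  rw [gap_one, gap_two, norm_conj_add]

theorem conj_mem_pants {z : ℂ} (hz : z ∈ pants) : conj z ∈ pants := by
  rw [mem_pants_iff_gap] at hz ⊢
  rw [Fin.forall_fin_succ, Fin.forall_fin_two]
  simp only [Fin.succ_zero_eq_one, Fin.succ_one_eq_two, gap_conj_zero, gap_conj_one, gap_conj_two]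
  exact ⟨hz 0, hz 2, hz 1⟩

/-- The map `spread`, or its mirror image. -/
def spreadBool (b : Bool) (z : ℂ) : ℂ := cond b (spread z) (conj (spread (conj z)))

theorem continuous_spreadBool (b : Bool) : Continuous (spreadBool b) := by
  cases b
  · exact Complex.continuous_conj.comp (continuous_spread.comp Complex.continuous_conj)
  · exact continuous_spread

theorem spreadBool_ne_zero (b : Bool) {z : ℂ} (hz : z ∈ pants) : spreadBool b z ≠ 0 := by
  cases b
  · exact (map_ne_zero _).2 (spread_ne_zero (conj_mem_pants hz))
  · exact spread_ne_zero hz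

/-- The map from the lift of a pair of pants on a given sheet to the earring. -/
def sheetMap : Sheet → ℂ → earring
  | none, _ => origin
  | some (_, x, b), z => radialOpt x (spreadBool b z)

theorem continuousAt_sheetMap (s : Sheet) {z : ℂ} (hz : z ∈ pants) :
    ContinuousAt (sheetMap s) z := by
  rcases s with _ | ⟨j, x, b⟩
  · exact continuousAt_const
  · exact (continuousAt_radialOpt x (spreadBool_ne_zero b hz)).comp
      (continuous_spreadBool b).continuousAt

/-- Near a boundary circle `spreadBool` is either the direction from its centre or the constant -1,
and direction -1 is the base point of every circle. -/
theorem sheetMap_of_gap_lt (s : Sheet) {k : Fin 3} {z : ℂ} (h : gap k z < 1 / 16) :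
    sheetMap s z = radialOpt (pantsLabel k s) (z - ctr k) := by
  rcases s with _ | ⟨j, x, b⟩
  · rfl
  · change radialOpt x (spreadBool b z) = _
    fin_cases k
    · have : spreadBool b z = z := by
        cases b
        · exact (congrArg conj (spread_of_gap_zero (by rwa [gap_conj_zero]))).trans
            (Complex.conj_conj z)
        · exact spread_of_gap_zero h
      rw [this]
      simp [pantsLabel, ctr]
    · cases b
      · have : spreadBool false z = -1 := by
          refine (congrArg conj (spread_of_gap_two (by rwa [gap_conj_two]))).trans ?_
          simp
        rw [this, radialOpt_neg_one]
        rfl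
      · have : spreadBool true z = z - Complex.I / 2 := spread_of_gap_one h
        rw [this]
        rfl
    · cases b
      · have : spreadBool false z = z - -(Complex.I / 2) := by
          refine (congrArg conj (spread_of_gap_one (by rwa [gap_conj_one]))).trans ?_
          rw [map_sub, Complex.conj_conj, conj_I_half]
        rw [this]
        rfl
      · have : spreadBool true z = -1 := spread_of_gap_two h
        rw [this, radialOpt_neg_one]
        rfl

/-! ## A covering space of the Hawaiian Pants -/

instance : TopologicalSpace Sheet := ⊥

instance : DiscreteTopology Sheet := ⟨rfl⟩

open Classical in
/-- The transition from the coordinate on the pairs of pants to that on the collar. -/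
def transition : Space → Equiv.Perm Sheet :=
  Space.desc (fun _ => 1) (fun n z => if depth z = 0 then 1 else sheetPerm (region z) n)
    fun _ _ z h => if_pos (depth_eq_zero z.2 h)

theorem transition_mkP (n : ℕ+) {z : pants} (hz : 0 < depth z) {k : Fin 3}
    (h : gap k z < 1 / 16) : transition (mkP n z) = sheetPerm k n := by
  rw [← region_eq h]
  exact if_neg hz.ne'

/-- On the overlap, a union of collars with the boundary removed, the transition is locally
constant. -/
theorem continuousOn_transition (g : Equiv.Perm Sheet → Sheet) :
    ContinuousOn (fun x => g (transition x)) (collar ∩ pantsInterior) := by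
  refine continuousOn_space (isOpen_collar.inter isOpen_pantsInterior)
    (fun z hz => (mkE_notMem_pantsInterior z hz.2).elim) fun n z hz => ?_
  obtain ⟨k, hk⟩ := exists_gap_of_mem_collar hz.1
  refine (continuousAt_const : ContinuousAt (fun _ => g (sheetPerm k n)) z).congr ?_
  filter_upwards [eventually_gap_lt hk, eventually_depth_pos hz.2] with w hw hw'
  rw [transition_mkP n hw' hw]

open Classical in
/-- The map to the earring on the pairs of pants of a given sheet. -/
def pantsMap (s : Sheet) : Space → earring :=
  Space.desc (fun _ => origin) (fun _ z => if depth z = 0 then origin else sheetMap s z)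
    fun _ _ z h => if_pos (depth_eq_zero z.2 h)

theorem pantsMap_mkP (s : Sheet) (n : ℕ+) {z : pants} (hz : 0 < depth z) :
    pantsMap s (mkP n z) = sheetMap s z := if_neg hz.ne'

theorem continuousOn_pantsMap (s : Sheet) : ContinuousOn (pantsMap s) pantsInterior := by
  refine continuousOn_space isOpen_pantsInterior
    (fun z hz => (mkE_notMem_pantsInterior z hz).elim) fun n z hz => ?_
  have h : ContinuousAt (fun w : pants => sheetMap s w) z :=
    (continuousAt_sheetMap s z.2).comp continuousAt_subtype_val
  refine h.congr ?_
  filter_upwards [eventually_depth_pos hz] with w hw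
  exact (pantsMap_mkP s n hw).symm

/-- The domains of the two charts. -/
def chartSet (i : Bool) : Set Space := cond i collar pantsInterior

/-- The coordinate changes to the two charts. -/
def chartPerm (i : Bool) (x : Space) : Equiv.Perm Sheet := cond i (transition x) 1

open Classical in
/-- The covering space of the Hawaiian Pants. -/
def sheetCore : FiberBundleCore Bool Space Sheet where
  baseSet := chartSet
  isOpen_baseSet i := by
    cases i
    · exact isOpen_pantsInterior
    · exact isOpen_collar
  indexAt x := decide (x ∈ collar)
  mem_baseSet_at x := by
    by_cases h : x ∈ collar
    · simp [h, chartSet]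
    · have h' : 1 / 16 ≤ spaceDepth x := not_lt.1 h
      have : x ∈ pantsInterior := lt_of_lt_of_le (by norm_num) h'
      simpa [h, chartSet] using this
  -- Writing the transition as a quotient of chart permutations makes the cocycle condition
  -- automatic.
  coordChange i j x := chartPerm j x * (chartPerm i x)⁻¹
  coordChange_self i x _ v := by simp
  continuousOn_coordChange i j := by
    refine continuousOn_prod_of_discrete_right.2 fun s => ?_
    have hset : {x : Space | (x, s) ∈ (chartSet i ∩ chartSet j) ×ˢ (Set.univ : Set Sheet)} =
        chartSet i ∩ chartSet j := by
      ext x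
      simp
    rw [hset]
    cases i <;> cases j
    · simpa [chartPerm] using continuousOn_const
    · rw [Set.inter_comm]
      exact continuousOn_transition fun e => (e * 1⁻¹) s
    · exact continuousOn_transition fun e => (1 * e⁻¹) s
    · simpa [chartPerm] using continuousOn_const
  coordChange_comp i j k x _ v := by simp

/-- The total space of the covering. -/
abbrev Cover : Type := sheetCore.TotalSpace

/-- The covering projection. -/
abbrev coverProj : Cover → Space := sheetCore.proj

theorem isCoveringMap_coverProj : IsCoveringMap coverProj :=
  IsFiberBundle.isCoveringMap fun x => ⟨sheetCore.localTrivAt x, sheetCore.mem_localTrivAt_baseSet x⟩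

/-- The map to the earring in the two charts. -/
def chartMap (i : Bool) (x : Space) (s : Sheet) : earring :=
  cond i (relabel (sheetLabel s) (collarRetr x)) (pantsMap s x)

/-- The permutations were chosen for this: they match the label of a boundary circle on a pants
sheet with that of its attaching circle on a collar sheet. -/
theorem chartMap_transition {x : Space} (hx : x ∈ collar ∩ pantsInterior) (s : Sheet) :
    chartMap true x (transition x s) = chartMap false x s := by
  rcases space_cases x with ⟨z, rfl⟩ | ⟨n, z, rfl⟩
  · exact (mkE_notMem_pantsInterior z hx.2).elim
  · obtain ⟨k, hk⟩ := exists_gap_of_mem_collar hx.1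
    change relabel (sheetLabel (transition (mkP n z) s)) (collarRetr (mkP n z)) =
      pantsMap s (mkP n z)
    rw [collarRetr_mkP n hk, relabel_radial, transition_mkP n hx.2 hk, sheetLabel_sheetPerm,
      pantsMap_mkP s n hx.2, sheetMap_of_gap_lt s hk]

theorem chartMap_coordChange (i j : Bool) {x : Space} (hx : x ∈ chartSet i ∩ chartSet j)
    (s : Sheet) : chartMap j x (sheetCore.coordChange i j x s) = chartMap i x s := by
  change chartMap j x ((chartPerm j x * (chartPerm i x)⁻¹) s) = _
  cases i <;> cases j
  · simp [chartPerm]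
  · simpa [chartPerm] using chartMap_transition hx.symm s
  · have := chartMap_transition hx ((transition x)⁻¹ s)
    rw [← Equiv.Perm.mul_apply, mul_inv_cancel, Equiv.Perm.one_apply] at this
    simpa [chartPerm] using this.symm
  · simp [chartPerm]

theorem continuousOn_chartMap (i : Bool) :
    ContinuousOn (fun p : Space × Sheet => chartMap i p.1 p.2) (chartSet i ×ˢ Set.univ) := by
  refine continuousOn_prod_of_discrete_right.2 fun s => ?_
  have hset : {x : Space | (x, s) ∈ chartSet i ×ˢ (Set.univ : Set Sheet)} = chartSet i := by
    ext x
    simp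
  rw [hset]
  cases i
  · exact continuousOn_pantsMap s
  · exact (continuous_relabel_sheetLabel s).comp_continuousOn continuousOn_collarRetr

/-- The map from the covering space to the earring. -/
def coverMap (p : Cover) : earring := chartMap (sheetCore.indexAt p.1) p.1 p.2

theorem coverMap_eq (i : Bool) {p : Cover} (hp : p.1 ∈ chartSet i) :
    coverMap p = chartMap i (sheetCore.localTriv i p).1 (sheetCore.localTriv i p).2 :=
  (chartMap_coordChange _ i ⟨sheetCore.mem_baseSet_at p.1, hp⟩ p.2).symm

theorem continuous_coverMap : Continuous coverMap := by
  refine continuous_iff_continuousAt.2 fun p => ?_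
  set i := sheetCore.indexAt p.1 with hi
  have hp : p ∈ (sheetCore.localTriv i).source :=
    (sheetCore.mem_localTriv_source i p).2 (sheetCore.mem_baseSet_at p.1)
  have ho := (sheetCore.localTriv i).open_source
  have hc : ContinuousOn (fun q => chartMap i (sheetCore.localTriv i q).1
      (sheetCore.localTriv i q).2) (sheetCore.localTriv i).source :=
    (continuousOn_chartMap i).comp (sheetCore.localTriv i).continuousOn_toFun fun q hq =>
      ⟨(sheetCore.mem_localTriv_source i q).1 hq, trivial⟩
  refine (hc.continuousAt (ho.mem_nhds hp)).congr ?_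
  filter_upwards [ho.mem_nhds hp] with q hq
  exact (coverMap_eq i ((sheetCore.mem_localTriv_source i q).1 hq)).symm

/-- The lift of the earring to the sheet on which all circles keep their labels. -/
def coverSection (z : earring) : Cover :=
  (sheetCore.localTriv true).toOpenPartialHomeomorph.symm (mkE z, none)

theorem mem_target_localTriv (z : earring) :
    (mkE z, (none : Sheet)) ∈ (sheetCore.localTriv true).target :=
  (sheetCore.mem_localTriv_target true _).2 (mkE_mem_collar z)

theorem continuous_coverSection : Continuous coverSection :=
  (sheetCore.localTriv true).continuousOn_invFun.comp_continuous
    (continuous_mkE.prodMk continuous_const) mem_target_localTriv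

theorem coverProj_coverSection (z : earring) : coverProj (coverSection z) = mkE z :=
  (sheetCore.localTriv true).proj_symm_apply (mem_target_localTriv z)

theorem coverMap_coverSection (z : earring) : coverMap (coverSection z) = z := by
  have h : sheetCore.localTriv true (coverSection z) = (mkE z, none) :=
    (sheetCore.localTriv true).apply_symm_apply (mem_target_localTriv z)
  have h' : (coverSection z).1 ∈ chartSet true := by
    rw [show (coverSection z).1 = mkE z from coverProj_coverSection z]
    exact mkE_mem_collar z
  rw [coverMap_eq true h', h]
  exact relabel_some z

/-- The inclusion of the earring into the Hawaiian Pants is injective on homotopy classes of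
paths. -/
theorem homotopic_of_map_mkE {z z' : earring} (γ δ : Path z z')
    (h : (γ.map continuous_mkE).Homotopic (δ.map continuous_mkE)) : γ.Homotopic δ := by
  have hcov := isCoveringMap_coverProj
  have key : ((γ.map continuous_coverSection).toContinuousMap).HomotopicRel
      ((δ.map continuous_coverSection).toContinuousMap) {0, 1} := by
    -- The lifts of γ and δ agree at 0, so the homotopy of their projections lifts; `coverMap` then
    -- returns it to the earring.
    refine (hcov.homotopicRel_iff_comp ⟨0, by simp, by simp⟩).2 ?_
    have e : ∀ ε : Path z z', (ContinuousMap.comp ⟨coverProj, hcov.continuous⟩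
        (ε.map continuous_coverSection).toContinuousMap) =
        (ε.map continuous_mkE).toContinuousMap := fun ε =>
      ContinuousMap.ext fun t => coverProj_coverSection (ε t)
    rw [e, e]
    exact h
  have key' := key.comp_continuousMap ⟨coverMap, continuous_coverMap⟩
  have e : ∀ ε : Path z z', (ContinuousMap.comp ⟨coverMap, continuous_coverMap⟩
      (ε.map continuous_coverSection).toContinuousMap) = ε.toContinuousMap := fun ε =>
    ContinuousMap.ext fun t => coverMap_coverSection (ε t)
  rw [e, e] at key'
  exact key'

end

end HawaiianPants

theorem mainTheorem8 :
    HawaiianPants.IsGeneralizedCoveringProjection.{w} HawaiianPants.proj ∧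
      Subsingleton (FundamentalGroup HawaiianPants.UnivCover HawaiianPants.univBase) ∧
      SimplyConnectedSpace HawaiianPants.UnivCover := by
  have h := HawaiianPants.hasUniquePathLifting_space HawaiianPants.homotopic_of_map_mkE
  have := h.simplyConnectedSpace
  exact ⟨h.isGeneralizedCoveringProjection, inferInstance, this⟩
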